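/- **Theorem (Gray).** Let $M$ be a connected smooth six-manifold with an $SU(3)$-structure, i.e. a Riemannian metric $\langle\cdot,\cdot\rangle$, an orthogonal almost complex structure $I$, and a complex volume form $\Psi=\psi_++i\psi_-$: a smooth complex-valued $3$-form that is complex multilinear for $I$, so $\Psi(IX,Y,Z)=i\Psi(X,Y,Z)$, with $\langle\Psi,\Psi\rangle_{\mathbb C}=\frac1{3!}\sum_{i,j,k=1}^{3}|\Psi(u_i,u_j,u_k)|^2=1$ for every basis $u_1,u_2,u_3$ of a tangent space that is unitary for $\langle\cdot,\cdot\rangle+i\omega$, where $\omega(X,Y)=\langle X,IY\rangle$. Let $\nabla$ be the Levi-Civita connection, $R_{X,Y}=\nabla_{[X,Y]}-[\nabla_X,\nabla_Y]$ and, for an orthonormal basis $(e_i)$, $$\mathrm{Ric}(X,Y)=\sum_i\langle R_{X,e_i}Y,e_i\rangle,\qquad \mathrm{Ric}^*(X,Y)=\sum_i\langle R_{X,e_i}IY,Ie_i\rangle .$$ The intrinsic torsion is the unique section $T$ of $T^*M\otimes\mathfrak{su}(3)^\perp$ ($\perp$ taken in $\mathfrak{so}(6)$) such that $\nabla+T$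 is an $SU(3)$-connection, i.e. annihilates $\omega,\psi_+,\psi_-$. Let $\mathcal W_5=T^*M\otimes\mathbb R I$ be the space of tensors $\eta_XY=\hat\eta(X)IY$ with $\hat\eta$ a one-form; let $\mathcal W_1$ be the space of $\xi\in T^*M\otimes\mathfrak u(3)^\perp$ for which the tensor $a=-\xi\omega$, $a(X,Y,Z)=\omega(\xi_XY,Z)+\omega(Y,\xi_XZ)$, satisfies $a(X,X,Z)=0$; and let $\mathcal W_1^+$ (resp. $\mathcal W_1^-$) consist of the $\xi\in\mathcal W_1$ for which the bilinear form $r(X,Y)=\frac12\langle X\lrcorner\psi_+,Y\lrcorner a\rangle$ is symmetric (resp. skew-symmetric), where $\langle b,c\rangle=\frac1{2!}\sum_{i,j}b(e_i,e_j)c(e_i,e_j)$ for two-forms $b,c$. The structure is said to be of type $\mathcal W$ if its intrinsic torsion lies in $\mathcal W$ at every point. Suppose that the structure is of type $\mathcal W_1^++\mathcal W_1^-+\mathcal W_5$ and not of type $\mathcal W_5$. Then there are smooth functions $w_1^+,w_1^-$ on $M$ with $\nabla\omega=w_1^+\psi_++w_1^-\psi_-$, that is, $(\nabla_X\omega)(Y,Z)=w_1^+\psi_+(X,Y,Z)+w_1^-\psi_-(X,Y,Z)$;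 the function $\alpha=(w_1^+)^2+(w_1^-)^2$ is a positive constant; and $$\mathrm{Ric}=5\,\mathrm{Ric}^*=5\alpha\,\langle\cdot,\cdot\rangle .$$ In particular $M$ is an Einstein manifold. -/

import Mathlib

open Bundle FiberBundle VectorField
open scoped Manifold ContDiff Topology

noncomputable section LeviCivita

variable {E : Type*} [NormedAddCommGroup E] [NormedSpace ℝ E] [FiniteDimensional ℝ E]
  {H : Type*} [TopologicalSpace H] {I : ModelWithCorners ℝ E H}
  {M : Type*} [TopologicalSpace M] [ChartedSpace H M] [IsManifold I ∞ M]
  [RiemannianBundle (fun x : M ↦ TangentSpace I x)]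
  [IsContMDiffRiemannianBundle I ∞ E (fun x : M ↦ TangentSpace I x)]

local notation "⟪" u ", " v "⟫" => inner ℝ u v

/-- Tangent spaces are finite-dimensional. -/
instance tangentSpace_finiteDimensional (x : M) : FiniteDimensional ℝ (TangentSpace I x) :=
  inferInstanceAs (FiniteDimensional ℝ E)

/-- The Koszul expression: half of `X⟨Y, Z⟩ + Y⟨X, Z⟩ - Z⟨X, Y⟩ + ⟨[X, Y], Z⟩ - ⟨[X, Z], Y⟩ - ⟨[Y, Z], X⟩`,
which equals `⟨∇_X Y, Z⟩` for the Levi-Civita connection `∇`. -/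
def koszul (X Y Z : Π x : M, TangentSpace I x) (x : M) : ℝ :=
  (1 / 2) * (d% (fun y ↦ ⟪Y y, Z y⟫) x (X x) + d% (fun y ↦ ⟪X y, Z y⟫) x (Y x)
    - d% (fun y ↦ ⟪X y, Y y⟫) x (Z x)
    + ⟪mlieBracket I X Y x, Z x⟫ - ⟪mlieBracket I X Z x, Y x⟫ - ⟪mlieBracket I Y Z x, X x⟫)

theorem mdifferentiableAt_inner {x : M} {X Y : Π x : M, TangentSpace I x}
    (hX : MDiffAt (T% X) x) (hY : MDiffAt (T% Y) x) : MDiffAt (fun y ↦ ⟪X y, Y y⟫) x :=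
  MDifferentiableAt.inner_bundle (F := E) (E := fun x : M ↦ TangentSpace I x) (b := id) hX hY

theorem koszul_tensorial_left {x : M} {Y Z : Π x : M, TangentSpace I x}
    (hY : MDiffAt (T% Y) x) (hZ : MDiffAt (T% Z) x) :
    TensorialAt I E (fun X ↦ koszul X Y Z x) x where
  smul {f X} hf hX := by
    have e1 : (fun y ↦ ⟪(f • X) y, Z y⟫) = fun y ↦ f y * ⟪X y, Z y⟫ := by
      ext y; simp [inner_smul_left]
    have e2 : (fun y ↦ ⟪(f • X) y, Y y⟫) = fun y ↦ f y * ⟪X y, Y y⟫ := by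
      ext y; simp [inner_smul_left]
    simp only [koszul, e1, e2, mvfderiv_fun_mul hf (mdifferentiableAt_inner hX hZ),
      mvfderiv_fun_mul hf (mdifferentiableAt_inner hX hY), mlieBracket_smul_left hf hX]
    simp [inner_add_left, inner_smul_left, inner_smul_right, real_inner_comm]
    ring
  add {X X'} hX hX' := by
    have e1 : (fun y ↦ ⟪(X + X') y, Z y⟫) = fun y ↦ ⟪X y, Z y⟫ + ⟪X' y, Z y⟫ := by
      ext y; simp [inner_add_left]
    have e2 : (fun y ↦ ⟪(X + X') y, Y y⟫) = fun y ↦ ⟪X y, Y y⟫ + ⟪X' y, Y y⟫ := by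
      ext y; simp [inner_add_left]
    simp only [koszul, e1, e2, mvfderiv_fun_add (mdifferentiableAt_inner hX hZ) (mdifferentiableAt_inner hX' hZ),
      mvfderiv_fun_add (mdifferentiableAt_inner hX hY) (mdifferentiableAt_inner hX' hY), mlieBracket_add_left hX hX']
    simp [inner_add_left, inner_add_right]
    ring

theorem koszul_tensorial_right {x : M} {X Y : Π x : M, TangentSpace I x}
    (hX : MDiffAt (T% X) x) (hY : MDiffAt (T% Y) x) :
    TensorialAt I E (fun Z ↦ koszul X Y Z x) x where
  smul {f Z} hf hZ := by
    have e1 : (fun y ↦ ⟪X y, (f • Z) y⟫) = fun y ↦ f y * ⟪X y, Z y⟫ := by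
      ext y; simp [inner_smul_right]
    have e2 : (fun y ↦ ⟪Y y, (f • Z) y⟫) = fun y ↦ f y * ⟪Y y, Z y⟫ := by
      ext y; simp [inner_smul_right]
    simp only [koszul, e1, e2, mvfderiv_fun_mul hf (mdifferentiableAt_inner hX hZ),
      mvfderiv_fun_mul hf (mdifferentiableAt_inner hY hZ), mlieBracket_smul_right hf hZ]
    simp [inner_add_left, inner_smul_left, inner_smul_right, real_inner_comm]
    ring
  add {Z Z'} hZ hZ' := by
    have e1 : (fun y ↦ ⟪X y, (Z + Z') y⟫) = fun y ↦ ⟪X y, Z y⟫ + ⟪X y, Z' y⟫ := by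
      ext y; simp [inner_add_right]
    have e2 : (fun y ↦ ⟪Y y, (Z + Z') y⟫) = fun y ↦ ⟪Y y, Z y⟫ + ⟪Y y, Z' y⟫ := by
      ext y; simp [inner_add_right]
    simp only [koszul, e1, e2, mvfderiv_fun_add (mdifferentiableAt_inner hX hZ) (mdifferentiableAt_inner hX hZ'),
      mvfderiv_fun_add (mdifferentiableAt_inner hY hZ) (mdifferentiableAt_inner hY hZ'), mlieBracket_add_right hZ hZ']
    simp [inner_add_left, inner_add_right]
    ring

/-- For a vector field `Y` differentiable at `x`, the Koszul expression as a bilinear form in the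
values of `X` and `Z` at `x`. -/
def koszulHom (Y : Π x : M, TangentSpace I x) {x : M} (hY : MDiffAt (T% Y) x) :
    TangentSpace I x →L[ℝ] TangentSpace I x →L[ℝ] ℝ :=
  TensorialAt.mkHom₂ (I := I) (F := E) (F' := E) (fun X Z ↦ koszul X Y Z x) x
    (fun _ hZ ↦ koszul_tensorial_left hY hZ) (fun _ hX ↦ koszul_tensorial_right hX hY)

open scoped Classical in
/-- `leviCivitaFun Y x u` is the vector `∇_u Y` determined by the Koszul formula, with value `0`
where `Y` is not differentiable. -/
def leviCivitaFun (Y : Π x : M, TangentSpace I x) (x : M) :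
    TangentSpace I x →L[ℝ] TangentSpace I x :=
  if hY : MDiffAt (T% Y) x then
    ∑ i, ((koszulHom Y hY).flip (stdOrthonormalBasis ℝ (TangentSpace I x) i)).smulRight
      (stdOrthonormalBasis ℝ (TangentSpace I x) i)
  else 0

theorem inner_leviCivitaFun {X Y Z : Π x : M, TangentSpace I x} {x : M}
    (hX : MDiffAt (T% X) x) (hY : MDiffAt (T% Y) x) (hZ : MDiffAt (T% Z) x) :
    ⟪leviCivitaFun Y x (X x), Z x⟫ = koszul X Y Z x := by
  have h : koszulHom Y hY (X x) (Z x) = koszul X Y Z x :=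
    TensorialAt.mkHom₂_apply (I := I) (F := E) (F' := E) (Φ := fun X Z ↦ koszul X Y Z x)
      (fun _ hZ ↦ koszul_tensorial_left hY hZ) (fun _ hX ↦ koszul_tensorial_right hX hY) hX hZ
  rw [← h]
  conv_rhs => rw [← (stdOrthonormalBasis ℝ (TangentSpace I x)).sum_repr' (Z x)]
  simp [leviCivitaFun, hY, sum_inner, inner_smul_left, mul_comm]

theorem ext_inner_extend {x : M} {A B : TangentSpace I x →L[ℝ] TangentSpace I x}
    (h : ∀ X Z : Π x : M, TangentSpace I x, MDiffAt (T% X) x → MDiffAt (T% Z) x →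
      ⟪A (X x), Z x⟫ = ⟪B (X x), Z x⟫) : A = B := by
  ext u
  refine ext_inner_right ℝ fun v ↦ ?_
  have := h (extend E u) (extend E v) (mdifferentiableAt_extend I E u)
    (mdifferentiableAt_extend I E v)
  simpa using this

variable (I M) in
/-- The Levi-Civita connection of the Riemannian metric; `leviCivita I M Y x u` is `∇_u Y` at `x`. -/
def leviCivita : CovariantDerivative I E (fun x : M ↦ TangentSpace I x) where
  toFun := leviCivitaFun
  isCovariantDerivativeOnUniv :=
    { add := by
        intro Y Y' x hY hY' _
        refine ext_inner_extend fun X Z hX hZ ↦ ?_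
        have hs : MDiffAt (T% (Y + Y')) x := mdifferentiableAt_add_section hY hY'
        have e1 : (fun y ↦ ⟪(Y + Y') y, Z y⟫) = fun y ↦ ⟪Y y, Z y⟫ + ⟪Y' y, Z y⟫ := by
          ext y; simp [inner_add_left]
        have e2 : (fun y ↦ ⟪X y, (Y + Y') y⟫) = fun y ↦ ⟪X y, Y y⟫ + ⟪X y, Y' y⟫ := by
          ext y; simp [inner_add_right]
        rw [inner_leviCivitaFun hX hs hZ, add_apply, inner_add_left,
          inner_leviCivitaFun hX hY hZ, inner_leviCivitaFun hX hY' hZ]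
        simp only [koszul, e1, e2, mvfderiv_fun_add (mdifferentiableAt_inner hY hZ) (mdifferentiableAt_inner hY' hZ),
          mvfderiv_fun_add (mdifferentiableAt_inner hX hY) (mdifferentiableAt_inner hX hY'),
          mlieBracket_add_left hY hY', mlieBracket_add_right hY hY']
        simp [inner_add_left, inner_add_right]
        ring
      leibniz := by
        intro Y f x hY hf _
        refine ext_inner_extend fun X Z hX hZ ↦ ?_
        have hs : MDiffAt (T% (f • Y)) x := hf.smul_section hY
        have e1 : (fun y ↦ ⟪(f • Y) y, Z y⟫) = fun y ↦ f y * ⟪Y y, Z y⟫ := by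
          ext y; simp [inner_smul_left]
        have e2 : (fun y ↦ ⟪X y, (f • Y) y⟫) = fun y ↦ f y * ⟪X y, Y y⟫ := by
          ext y; simp [inner_smul_right]
        rw [inner_leviCivitaFun hX hs hZ, add_apply, inner_add_left,
          smul_apply, inner_smul_left, inner_leviCivitaFun hX hY hZ]
        simp only [koszul, e1, e2, mvfderiv_fun_mul hf (mdifferentiableAt_inner hY hZ),
          mvfderiv_fun_mul hf (mdifferentiableAt_inner hX hY),
          mlieBracket_smul_left hf hY, mlieBracket_smul_right hf hY]
        simp [inner_add_left, inner_smul_left, inner_smul_right, real_inner_comm]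
        ring }

/-- The Levi-Civita connection is metric: `X⟨Y, Z⟩ = ⟨∇_X Y, Z⟩ + ⟨Y, ∇_X Z⟩`. -/
theorem leviCivita_metric {x : M} {X Y Z : Π x : M, TangentSpace I x} (hX : MDiffAt (T% X) x)
    (hY : MDiffAt (T% Y) x) (hZ : MDiffAt (T% Z) x) :
    d% (fun y ↦ ⟪Y y, Z y⟫) x (X x) =
      ⟪leviCivita I M Y x (X x), Z x⟫ + ⟪Y x, leviCivita I M Z x (X x)⟫ := by
  have h1 := inner_leviCivitaFun hX hY hZ
  have h2 := inner_leviCivitaFun hX hZ hY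
  rw [real_inner_comm] at h2
  change _ = ⟪leviCivitaFun Y x (X x), Z x⟫ + ⟪Y x, leviCivitaFun Z x (X x)⟫
  rw [h1, h2]
  have e : (fun y ↦ ⟪Z y, Y y⟫) = fun y ↦ ⟪Y y, Z y⟫ := by
    ext y; exact real_inner_comm _ _
  simp only [koszul, e, mlieBracket_swap_apply (V := Z) (W := Y)]
  simp
  ring

/-- The Levi-Civita connection is torsion-free. -/
theorem leviCivita_torsion : (leviCivita I M).torsion = 0 := by
  rw [CovariantDerivative.torsion_eq_zero_iff]
  intro X Y x hX hY
  refine ext_inner_right ℝ fun v ↦ ?_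
  have hZ := mdifferentiableAt_extend I E v
  have h1 := inner_leviCivitaFun hX hY hZ
  have h2 := inner_leviCivitaFun hY hX hZ
  rw [extend_apply_self] at h1 h2
  rw [inner_sub_left]
  change ⟪leviCivitaFun Y x (X x), v⟫ - ⟪leviCivitaFun X x (Y x), v⟫ = _
  rw [h1, h2]
  have e : (fun y ↦ ⟪Y y, X y⟫) = fun y ↦ ⟪X y, Y y⟫ := by
    ext y; exact real_inner_comm _ _
  simp only [koszul, e, mlieBracket_swap_apply (V := Y) (W := X), extend_apply_self]
  simp
  ring

variable (I M) in
/-- The curvature operator `R_{u,v} w` at `x`, for the sign convention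
`R_{X,Y} = ∇_{[X,Y]} - [∇_X, ∇_Y]`, computed on local smooth extensions of the tangent vectors. -/
def curvature (x : M) (u v w : TangentSpace I x) : TangentSpace I x :=
  let X : Π y : M, TangentSpace I y := extend E u
  let Y : Π y : M, TangentSpace I y := extend E v
  let Z : Π y : M, TangentSpace I y := extend E w
  leviCivita I M Z x (mlieBracket I X Y x)
    - (leviCivita I M (fun y ↦ leviCivita I M Z y (Y y)) x u
      - leviCivita I M (fun y ↦ leviCivita I M Z y (X y)) x v)

variable (I M) in
/-- The Ricci curvature `Ric(u, v) = ∑ᵢ ⟨R_{u,eᵢ} v, eᵢ⟩`, `(eᵢ)` an orthonormal basis. -/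
def ricci (x : M) (u v : TangentSpace I x) : ℝ :=
  ∑ i, ⟪curvature I M x u (stdOrthonormalBasis ℝ (TangentSpace I x) i) v,
    stdOrthonormalBasis ℝ (TangentSpace I x) i⟫

variable (M) in
/-- The `*`-Ricci curvature `Ric*(u, v) = ∑ᵢ ⟨R_{u,eᵢ} Jv, J eᵢ⟩` of an almost Hermitian structure
with almost complex structure `J`. -/
def ricciStar (J : Π x : M, TangentSpace I x →L[ℝ] TangentSpace I x) (x : M)
    (u v : TangentSpace I x) : ℝ :=
  ∑ i, ⟪curvature I M x u (stdOrthonormalBasis ℝ (TangentSpace I x) i) (J x v),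
    J x (stdOrthonormalBasis ℝ (TangentSpace I x) i)⟫

/-- The covariant derivative of a field of `k`-linear forms:
`(∇_u φ)(v₁, …, v_k) = u(φ(V₁, …, V_k)) - ∑ᵢ φ(v₁, …, ∇_u Vᵢ, …, v_k)`
for local smooth extensions `Vᵢ` of the tangent vectors `vᵢ`. -/
def covDerivForm {k : ℕ} (φ : Π x : M, (Fin k → TangentSpace I x) → ℝ) (x : M)
    (u : TangentSpace I x) (v : Fin k → TangentSpace I x) : ℝ :=
  d% (fun y ↦ φ y (fun i ↦ extend E (v i) y)) x u
    - ∑ i, φ x (Function.update v i (leviCivita I M (extend E (v i)) x u))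

end LeviCivita

/-- The natural action of an endomorphism `A` on a `k`-form `φ`:
`(A φ)(v₁, …, v_k) = -∑ᵢ φ(v₁, …, A vᵢ, …, v_k)`. -/
def endAction {V : Type*} [AddCommGroup V] [Module ℝ V] {k : ℕ} (A : V →ₗ[ℝ] V)
    (φ : (Fin k → V) → ℝ) (v : Fin k → V) : ℝ :=
  -∑ i, φ (Function.update v i (A (v i)))

noncomputable section SpecialAlmostHermitian

/-- The model space of six-dimensional manifolds. -/
abbrev E6 : Type := EuclideanSpace ℝ (Fin 6)

local notation "⟪" u ", " v "⟫" => inner ℝ u v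

/-- An `SU(3)`-structure on a Riemannian six-manifold `M` (so that `M` is a special almost Hermitian
six-manifold): an orthogonal almost complex structure `J` and a complex volume form `Ψ`, both smooth.

`Ψ` is a complex-valued 3-form that is complex multilinear for `J`, normalised by `⟨Ψ, Ψ⟩_ℂ = 1`,
where `⟨Ψ, Ψ⟩_ℂ = (1 / 3!) ∑ Ψ(u_i, u_j, u_k) conj Ψ(u_i, u_j, u_k)` for a basis `u` that is unitary
for the Hermitian product `⟨·,·⟩ + i ω`, `ω(u, v) = ⟨u, Jv⟩`. -/
structure SU3Structure (M : Type*) [TopologicalSpace M] [ChartedSpace E6 M]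
    [IsManifold (𝓡 6) ∞ M] [RiemannianBundle (fun x : M ↦ TangentSpace (𝓡 6) x)] where
  /-- the almost complex structure -/
  J : Π x : M, TangentSpace (𝓡 6) x →L[ℝ] TangentSpace (𝓡 6) x
  contMDiff_J : ContMDiff (𝓡 6) ((𝓡 6).prod 𝓘(ℝ, E6 →L[ℝ] E6)) ∞
    (fun x ↦ TotalSpace.mk' (E6 →L[ℝ] E6)
      (E := fun x : M ↦ TangentSpace (𝓡 6) x →L[ℝ] TangentSpace (𝓡 6) x) x (J x))
  J_J : ∀ (x : M) (u : TangentSpace (𝓡 6) x), J x (J x u) = -u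
  inner_J_J : ∀ (x : M) (u v : TangentSpace (𝓡 6) x), ⟪J x u, J x v⟫ = ⟪u, v⟫
  /-- the complex volume form -/
  Ψ : Π x : M, (TangentSpace (𝓡 6) x) [⋀^Fin 3]→ₗ[ℝ] ℂ
  contMDiff_Ψ : ∀ (X : Fin 3 → Π x : M, TangentSpace (𝓡 6) x) (x : M),
    (∀ i, ContMDiffAt (𝓡 6) (𝓡 6).tangent ∞ (fun y ↦ (⟨y, X i y⟩ : TangentBundle (𝓡 6) M)) x) →
      ContMDiffAt (𝓡 6) 𝓘(ℝ, ℂ) ∞ (fun y ↦ Ψ y (fun i ↦ X i y)) x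
  Ψ_J : ∀ (x : M) (u v w : TangentSpace (𝓡 6) x),
    Ψ x ![J x u, v, w] = Complex.I * Ψ x ![u, v, w]
  Ψ_norm : ∀ (x : M) (u : Fin 3 → TangentSpace (𝓡 6) x),
    (∀ i j, (⟪u i, u j⟫ : ℂ) + Complex.I * (⟪u i, J x (u j)⟫ : ℝ) = if i = j then 1 else 0) →
      (1 / (Nat.factorial 3 : ℂ)) * ∑ i, ∑ j, ∑ k,
        Ψ x ![u i, u j, u k] * (starRingEnd ℂ) (Ψ x ![u i, u j, u k]) = 1

namespace SU3Structure

variable {M : Type*} [TopologicalSpace M] [ChartedSpace E6 M] [IsManifold (𝓡 6) ∞ M]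
  [RiemannianBundle (fun x : M ↦ TangentSpace (𝓡 6) x)]
  [IsContMDiffRiemannianBundle (𝓡 6) ∞ E6 (fun x : M ↦ TangentSpace (𝓡 6) x)]

variable (S : SU3Structure M)

/-- The Kähler form `ω(u, v) = ⟨u, Jv⟩`. -/
def kahlerForm (x : M) (v : Fin 2 → TangentSpace (𝓡 6) x) : ℝ := ⟪v 0, S.J x (v 1)⟫

/-- The real part `ψ₊` of the complex volume form. -/
def ψp (x : M) (v : Fin 3 → TangentSpace (𝓡 6) x) : ℝ := (S.Ψ x v).re

/-- The imaginary part `ψ₋` of the complex volume form. -/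
def ψm (x : M) (v : Fin 3 → TangentSpace (𝓡 6) x) : ℝ := (S.Ψ x v).im

/-- `(∇_u ω)(v, w)`, as a trilinear form in `(u, v, w)`. -/
def nablaKahler (x : M) (u v w : TangentSpace (𝓡 6) x) : ℝ := covDerivForm S.kahlerForm x u ![v, w]

/-- The Lie algebra `so(6)` of `T_x M`. -/
def so (x : M) : Set (Module.End ℝ (TangentSpace (𝓡 6) x)) :=
  {A | ∀ u v, ⟪A u, v⟫ = -⟪u, A v⟫}

/-- The Lie algebra `u(3)` of `T_x M`: skew endomorphisms that are complex linear. -/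
def unitaryAlg (x : M) : Set (Module.End ℝ (TangentSpace (𝓡 6) x)) :=
  {A | A ∈ so x ∧ ∀ u, A (S.J x u) = S.J x (A u)}

/-- The Lie algebra `su(3)` of `T_x M`: the elements of `u(3)` with vanishing complex trace
(the real part of the complex trace of a skew endomorphism vanishes; the imaginary part is a multiple
of the real trace of `J A`). -/
def specialUnitaryAlg (x : M) : Set (Module.End ℝ (TangentSpace (𝓡 6) x)) :=
  {A | A ∈ S.unitaryAlg x ∧
    LinearMap.trace ℝ (TangentSpace (𝓡 6) x) ((S.J x : Module.End ℝ (TangentSpace (𝓡 6) x)) * A) = 0}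

/-- The orthogonal complement in `so(6)` of a subset of `so(6)`, for the inner product
`-tr(A B)` (up to a factor). -/
def perp (x : M) (𝔤 : Set (Module.End ℝ (TangentSpace (𝓡 6) x))) :
    Set (Module.End ℝ (TangentSpace (𝓡 6) x)) :=
  {A | A ∈ so x ∧ ∀ B ∈ 𝔤, LinearMap.trace ℝ (TangentSpace (𝓡 6) x) (A * B) = 0}

/-- Elements of `T*M ⊗ End(TM)` at `x`: `T u v` is `T_u v`. -/
abbrev Torsion (x : M) : Type := TangentSpace (𝓡 6) x →ₗ[ℝ] Module.End ℝ (TangentSpace (𝓡 6) x)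

/-- `T` is the intrinsic torsion at `x` of the `SU(3)`-structure: it takes values in `su(3)^⊥` and
`∇ + T` is an `SU(3)`-connection, i.e. annihilates `ω`, `ψ₊` and `ψ₋` (it is metric since `T` takes
values in `so(6)`). These conditions determine `T` uniquely. -/
structure IsIntrinsicTorsion (x : M) (T : Torsion x) : Prop where
  mem_perp : ∀ u, T u ∈ perp x (S.specialUnitaryAlg x)
  parallel_kahlerForm : ∀ u v, covDerivForm S.kahlerForm x u v + endAction (T u) (S.kahlerForm x) v = 0
  parallel_ψp : ∀ u v, covDerivForm S.ψp x u v + endAction (T u) (S.ψp x) v = 0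
  parallel_ψm : ∀ u v, covDerivForm S.ψm x u v + endAction (T u) (S.ψm x) v = 0

/-- The tensor `a = -ξω ∈ T*M ⊗ Λ²T*M` associated with `ξ`. If `ξ + η` is the intrinsic torsion
(with `η ∈ T*M ⊗ ℝω`), then `a = ∇ω`. -/
def torsionForm (x : M) (ξ : Torsion x) (u v w : TangentSpace (𝓡 6) x) : ℝ :=
  -endAction (ξ u) (S.kahlerForm x) ![v, w]

/-- The Gray-Hervella module `W₁ ⊂ T*M ⊗ u(3)^⊥`: the tensors `ξ` for which `a = -ξω` satisfies
`a(u, u, w) = 0`. -/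
def W1 (x : M) : Set (Torsion x) :=
  {ξ | (∀ u, ξ u ∈ perp x (S.unitaryAlg x)) ∧ ∀ u w, S.torsionForm x ξ u u w = 0}

/-- The bilinear form `r(a)`, `2 r(a)(u, v) = ⟨u ⌟ ψ₊, v ⌟ a⟩` for `a = -ξω`, with the inner product
`⟨b, c⟩ = (1 / 2!) ∑ᵢⱼ b(eᵢ, eⱼ) c(eᵢ, eⱼ)` of 2-forms. -/
def r (x : M) (ξ : Torsion x) (u v : TangentSpace (𝓡 6) x) : ℝ :=
  (1 / 2) * ((1 / 2) * ∑ i, ∑ j,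
    S.ψp x ![u, stdOrthonormalBasis ℝ (TangentSpace (𝓡 6) x) i,
        stdOrthonormalBasis ℝ (TangentSpace (𝓡 6) x) j] *
      S.torsionForm x ξ v (stdOrthonormalBasis ℝ (TangentSpace (𝓡 6) x) i)
        (stdOrthonormalBasis ℝ (TangentSpace (𝓡 6) x) j))

/-- The `SU(3)`-module `W₁⁺`: elements of `W₁` with `r` symmetric. -/
def W1p (x : M) : Set (Torsion x) := {ξ | ξ ∈ S.W1 x ∧ ∀ u v, S.r x ξ u v = S.r x ξ v u}

/-- The `SU(3)`-module `W₁⁻`: elements of `W₁` with `r` skew-symmetric. -/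
def W1m (x : M) : Set (Torsion x) := {ξ | ξ ∈ S.W1 x ∧ ∀ u v, S.r x ξ u v = -S.r x ξ v u}

/-- The module `W₅ = T*M ⊗ ℝω`: the tensors `η_u v = η̂(u) Jv` with `η̂` a one-form. -/
def W5 (x : M) : Set (Torsion x) :=
  {η | ∃ ηhat : TangentSpace (𝓡 6) x →ₗ[ℝ] ℝ, ∀ u v, η u v = ηhat u • S.J x v}

/-- The structure is of type `𝒲`, where `𝒲 x ⊆ T*_x M ⊗ su(3)^⊥`: at each point the intrinsic
torsion lies in `𝒲`. -/
def IsOfType (𝒲 : Π x : M, Set (Torsion x)) : Prop :=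
  ∀ x : M, ∃ T : Torsion x, S.IsIntrinsicTorsion x T ∧ T ∈ 𝒲 x

/-- The sum `W₁⁺ + W₁⁻ + W₅`. -/
def W1pW1mW5 (x : M) : Set (Torsion x) :=
  {T | ∃ ξp ∈ S.W1p x, ∃ ξm ∈ S.W1m x, ∃ η ∈ S.W5 x, T = ξp + ξm + η}

end SU3Structure

end SpecialAlmostHermitian

/-!
Torsion in `W₁ ⊕ W₅` is recorded by a complex function `w` with `∇ω = Re (w̄Ψ)`, and then
`∇ Re (w̄Ψ) = Re (βΨ) - |w|² ⟨·, ·⟩ ∧ ω` for a complex one-form `β`. Let `K` be the difference of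
the curvature tensor and `|w|²` times that of the round unit sphere. The Ricci identity for `ω` says
`K(u, v, y, Jz) + K(u, v, Jy, z) = Re (β(u) Ψ(v, y, z) - β(v) Ψ(u, y, z))`. The Bianchi symmetries
of `K` force `β = 0`, so that `|w|²` is constant and `K` commutes with `J`. The Ricci identity for
`Re (w̄Ψ)` then puts `K` in `su(3)`, hence by the Bianchi identity `K` has no Ricci trace, and the
Ricci and *-Ricci tensors are those of a sphere, namely `5|w|² ⟨·, ·⟩` and `|w|² ⟨·, ·⟩`.
-/

noncomputable section ManifoldCalculus

variable {E : Type*} [NormedAddCommGroup E] [NormedSpace ℝ E]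
  {H : Type*} [TopologicalSpace H] {I : ModelWithCorners ℝ E H}
  {M : Type*} [TopologicalSpace M] [ChartedSpace H M]

theorem mvfderiv_congr_of_eventuallyEq {f g : M → ℝ} {x : M} (h : f =ᶠ[𝓝 x] g) :
    d% f x = (d% g x : TangentSpace I x →L[ℝ] ℝ) := by
  ext u
  exact DFunLike.congr_fun (h.mfderiv_eq (I := I) (I' := 𝓘(ℝ, ℝ))) u

theorem mdifferentiableAt_extChartAt_symm [I.Boundaryless] [IsManifold I 1 M] {x : M} {z : E}
    (hz : z ∈ (extChartAt I x).target) : MDiffAt (extChartAt I x).symm z := by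
  simpa only [I.range_eq_univ, mdifferentiableWithinAt_univ] using
    mdifferentiableWithinAt_extChartAt_symm (I := I) hz

theorem fderiv_comp_extChartAt_symm [I.Boundaryless] [IsManifold I 1 M] {x : M} {f : M → ℝ} {z : E}
    (hz : z ∈ (extChartAt I x).target) (hf : MDiffAt f ((extChartAt I x).symm z)) (w : E) :
    fderiv ℝ (f ∘ (extChartAt I x).symm) z w =
      d% f ((extChartAt I x).symm z) (mfderiv 𝓘(ℝ, E) I (extChartAt I x).symm z w) := by
  rw [← mvfderiv_comp_apply z hf (mdifferentiableAt_extChartAt_symm hz) w, mvfderiv,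
    mfderiv_eq_fderiv]
  rfl

theorem isLocallyConstant_of_mvfderiv_eq_zero [I.Boundaryless] [IsManifold I 1 M] {f : M → ℝ}
    (hf : ∀ x, MDiffAt f x) (h : ∀ x, (d% f x : TangentSpace I x →L[ℝ] ℝ) = 0) :
    IsLocallyConstant f := by
  rw [IsLocallyConstant.iff_eventually_eq]
  intro x
  set φ := extChartAt I x
  obtain ⟨ε, hε, hball⟩ :=
    Metric.isOpen_iff.1 (isOpen_extChartAt_target (I := I) x) _ (mem_extChartAt_target x)
  have hdiff : DifferentiableOn ℝ (f ∘ φ.symm) (Metric.ball (φ x) ε) := fun z hz ↦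
    ((hf _).comp z
      (mdifferentiableAt_extChartAt_symm (hball hz))).differentiableAt.differentiableWithinAt
  have hderiv : Set.EqOn (fderiv ℝ (f ∘ φ.symm)) 0 (Metric.ball (φ x) ε) := fun z hz ↦ by
    ext w
    rw [fderiv_comp_extChartAt_symm (hball hz) (hf _), h]
    rfl
  filter_upwards [(continuousAt_extChartAt (I := I) x).eventually (Metric.ball_mem_nhds _ hε),
    extChartAt_source_mem_nhds (I := I) x] with y hy hys
  have := Metric.isOpen_ball.is_const_of_fderiv_eq_zero (convex_ball _ ε).isPreconnected
    hdiff hderiv hy (Metric.mem_ball_self hε)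
  rwa [Function.comp_apply, Function.comp_apply, φ.left_inv hys,
    φ.left_inv (mem_extChartAt_source x)] at this

theorem contDiffAt_comp_extChartAt_symm [I.Boundaryless] {f : M → ℝ} {x : M}
    (hf : CMDiffAt ∞ f x) :
    ContDiffAt ℝ ∞ (f ∘ (extChartAt I x).symm) (extChartAt I x x) := by
  have h := (contMDiffAt_iff.1 hf).2
  rw [I.range_eq_univ, contDiffWithinAt_univ] at h
  simpa only [extChartAt_model_space_eq_id] using! h

variable [IsManifold I ∞ M]

theorem contMDiffAt_mvfderiv_apply {f : M → ℝ} {X : Π x : M, TangentSpace I x} {x : M}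
    (hf : CMDiffAt ∞ f x) (hX : CMDiffAt ∞ (T% X) x) :
    CMDiffAt ∞ (fun y ↦ d% f y (X y)) x := by
  have h := ContMDiffAt.clm_apply_of_inCoordinates (b₁ := id)
    (hf.mfderiv_const (m := ∞) le_rfl) hX hf
  rw [contMDiffAt_totalSpace] at h
  simpa [mvfderiv] using! h.2

theorem eventually_contMDiffAt_extend {x : M} (u : TangentSpace I x) :
    ∀ᶠ y in 𝓝 x, CMDiffAt ∞ (T% (extend E u)) y := by
  obtain ⟨s, hs, h⟩ := exists_contMDiffOn_extend (k := ∞) I E u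
  filter_upwards [eventually_mem_nhds_iff.2 hs] with y hy
  exact h.contMDiffAt hy

section Extend

variable [I.Boundaryless] {x y : M}

theorem extend_eq_mfderiv_extChartAt_symm (u : TangentSpace I x)
    (hy : y ∈ (extChartAt I x).source) :
    (extend E u : Π y : M, TangentSpace I y) y =
      mfderiv 𝓘(ℝ, E) I (extChartAt I x).symm (extChartAt I x y) u := by
  have hy' : y ∈ (chartAt H x).source := by rwa [← extChartAt_source I]
  let t := trivializationAt E (TangentSpace I : M → Type _) x
  have hu : (t ⟨x, u⟩).2 = u := by
    have h := TangentBundle.continuousLinearMapAt_trivializationAt (I := I) (mem_chart_source H x)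
    rw [mfderiv_extChartAt_self] at h
    have := DFunLike.congr_fun h u
    rwa [t.continuousLinearMapAt_apply_of_mem ℝ (mem_baseSet_trivializationAt E _ x)] at this
  have hsymm := TangentBundle.symmL_trivializationAt (I := I) hy'
  rw [I.range_eq_univ, mfderivWithin_univ] at hsymm
  have happly := t.symmL_apply (R := ℝ) (b := y) (by simpa [t] using hy') u
  rw [hsymm] at happly
  exact (congrArg (t.symm y) hu).trans happly.symm

/-- The vector field on a vector space with constant value `w`. -/
def constVectorField (w : E) : Π z : E, TangentSpace 𝓘(ℝ, E) z := fun _ ↦ w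

theorem mlieBracket_constVectorField (a b : E) :
    mlieBracket 𝓘(ℝ, E) (constVectorField a) (constVectorField b) = 0 := by
  rw [← mlieBracketWithin_univ, mlieBracketWithin_eq_lieBracketWithin]
  ext z
  have h (a : E) : fderivWithin ℝ (constVectorField a) Set.univ z = 0 :=
    fderivWithin_const_apply (c := a)
  simp only [lieBracketWithin, h]
  exact sub_self (0 : E)

theorem extend_eq_mpullback_constVectorField (u : TangentSpace I x)
    (hy : y ∈ (extChartAt I x).source) :
    (extend E u : Π y : M, TangentSpace I y) y =
      mpullback I 𝓘(ℝ, E) (extChartAt I x) (constVectorField (E := E) u) y := by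
  rw [extend_eq_mfderiv_extChartAt_symm u hy, mpullback_apply]
  have h := mfderiv_extChartAt_comp_mfderivWithin_extChartAt_symm' (I := I) hy
  rw [I.range_eq_univ, mfderivWithin_univ] at h
  exact ((isInvertible_mfderiv_extChartAt hy).inverse_apply_eq.2 (DFunLike.congr_fun h u).symm).symm

theorem mlieBracket_extend [CompleteSpace E] (u v : TangentSpace I x)
    (hy : y ∈ (extChartAt I x).source) :
    mlieBracket I (extend E u : Π y : M, TangentSpace I y) (extend E v) y = 0 := by
  have hpull (w : TangentSpace I x) : (extend E w : Π y : M, TangentSpace I y) =ᶠ[𝓝 y]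
      mpullback I 𝓘(ℝ, E) (extChartAt I x) (constVectorField (E := E) w) :=
    Filter.eventuallyEq_of_mem ((isOpen_extChartAt_source x).mem_nhds hy)
      fun z hz ↦ extend_eq_mpullback_constVectorField w hz
  have hconst (a : E) : MDiffAt (T% (constVectorField a)) (extChartAt I x y) := by
    rw [mdifferentiableAt_section]
    simpa [constVectorField] using! mdifferentiableAt_const
  have h2 : minSmoothness ℝ 2 ≤ ∞ := by
    rw [minSmoothness_of_isRCLikeNormedField]
    norm_cast
  have : IsManifold I (minSmoothness ℝ 2) M := IsManifold.of_le h2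
  have hchart : CMDiffAt ∞ (extChartAt I x) y :=
    contMDiffAt_extChartAt' (by rwa [← extChartAt_source I])
  rw [(hpull u).mlieBracket_vectorField_eq (hpull v),
    ← mpullback_mlieBracket (hconst u) (hconst v) hchart h2, mpullback_apply]
  exact (congrArg _ (congrFun (mlieBracket_constVectorField (E := E) u v) _)).trans (map_zero _)

theorem mvfderiv_extend {f : M → ℝ} (hf : MDiffAt f y) (u : TangentSpace I x)
    (hy : y ∈ (extChartAt I x).source) :
    d% f y ((extend E u : Π y : M, TangentSpace I y) y) =
      fderiv ℝ (f ∘ (extChartAt I x).symm) (extChartAt I x y) u := by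
  have hinv := (extChartAt I x).left_inv hy
  have := fderiv_comp_extChartAt_symm (I := I) ((extChartAt I x).map_source hy)
    (hinv.symm ▸ hf) u
  rw [this, extend_eq_mfderiv_extChartAt_symm u hy, hinv]

theorem mvfderiv_mvfderiv_extend {f : M → ℝ} (hf : ∀ᶠ y in 𝓝 x, CMDiffAt ∞ f y)
    (u v : TangentSpace I x) :
    d% (fun y ↦ d% f y ((extend E v : Π y : M, TangentSpace I y) y)) x u =
      fderiv ℝ (fderiv ℝ (f ∘ (extChartAt I x).symm)) (extChartAt I x x) u v := by
  set φ := extChartAt I x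
  have hx : x ∈ φ.source := mem_extChartAt_source x
  have hfd : MDiffAt (fun y ↦ d% f y ((extend E v : Π y : M, TangentSpace I y) y)) x :=
    (contMDiffAt_mvfderiv_apply hf.self_of_nhds
      (eventually_contMDiffAt_extend v).self_of_nhds).mdifferentiableAt (by simp)
  have hF2 : DifferentiableAt ℝ (fderiv ℝ (f ∘ φ.symm)) (φ x) :=
    ((contDiffAt_comp_extChartAt_symm hf.self_of_nhds).fderiv_right (m := ∞)
      le_rfl).differentiableAt (by simp)
  have hcoord : (fun y ↦ d% f y ((extend E v : Π y : M, TangentSpace I y) y)) ∘ φ.symm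
      =ᶠ[𝓝 (φ x)] fun z ↦ fderiv ℝ (f ∘ φ.symm) z v := by
    have hsymm := continuousAt_extChartAt_symm (I := I) x
    rw [ContinuousAt, φ.left_inv hx] at hsymm
    filter_upwards [(isOpen_extChartAt_target (I := I) x).mem_nhds (mem_extChartAt_target x),
      hsymm.eventually hf] with z hz hfz
    rw [Function.comp_apply, mvfderiv_extend (hfz.mdifferentiableAt (by simp)) v (φ.map_target hz),
      φ.right_inv hz]
  have hclm (a b : E) : fderiv ℝ (fun z ↦ fderiv ℝ (f ∘ φ.symm) z b) (φ x) a =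
      fderiv ℝ (fderiv ℝ (f ∘ φ.symm)) (φ x) a b := by
    simp [fderiv_clm_apply hF2 (differentiableAt_const b)]
  have h := mvfderiv_extend hfd u hx
  rw [extend_apply_self, hcoord.fderiv_eq] at h
  exact h.trans (hclm u v)

theorem mvfderiv_extend_comm {f : M → ℝ} (hf : ∀ᶠ y in 𝓝 x, CMDiffAt ∞ f y)
    (u v : TangentSpace I x) :
    d% (fun y ↦ d% f y ((extend E v : Π y : M, TangentSpace I y) y)) x u =
      d% (fun y ↦ d% f y ((extend E u : Π y : M, TangentSpace I y) y)) x v := by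
  rw [mvfderiv_mvfderiv_extend hf, mvfderiv_mvfderiv_extend hf]
  refine ((contDiffAt_comp_extChartAt_symm hf.self_of_nhds).isSymmSndFDerivAt ?_).eq u v
  rw [minSmoothness_of_isRCLikeNormedField]
  norm_cast

end Extend

end ManifoldCalculus

section Gram

open Matrix

variable {F : Type*} [NormedAddCommGroup F] [InnerProductSpace ℝ F]
  {n : Type*} [Fintype n] [DecidableEq n]

theorem det_gram_updateCol_inner_sum (s : n → F) (c : n → ℝ) (i : n) :
    ((gram ℝ s).updateCol i fun j ↦ inner ℝ (∑ k, c k • s k) (s j)).det =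
      (gram ℝ s).det * c i := by
  have h : (fun j ↦ inner ℝ (∑ k, c k • s k) (s j)) = gram ℝ s *ᵥ c := by
    ext j
    simp only [sum_inner, real_inner_smul_left, mulVec, dotProduct, gram_apply]
    exact Finset.sum_congr rfl fun k _ ↦ by rw [real_inner_comm, mul_comm]
  rw [h, ← cramer_apply, cramer_eq_adjugate_mulVec, mulVec_mulVec, adjugate_mul, smul_mulVec,
    one_mulVec, Pi.smul_apply, smul_eq_mul]

end Gram

noncomputable section LeviCivitaSmooth

section

variable {E : Type*} [NormedAddCommGroup E] [NormedSpace ℝ E] {H : Type*} [TopologicalSpace H]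
  {I : ModelWithCorners ℝ E H} {M : Type*} [TopologicalSpace M] [ChartedSpace H M]

theorem contMDiffAt_det {n : Type*} [Fintype n] [DecidableEq n] {G : M → Matrix n n ℝ} {x : M}
    (hG : ∀ i j, CMDiffAt ∞ (fun y ↦ G y i j) x) : CMDiffAt ∞ (fun y ↦ (G y).det) x := by
  simp only [Matrix.det_apply, Units.smul_def, zsmul_eq_mul]
  exact ContMDiffAt.sum fun σ _ ↦ contMDiffAt_const.mul (ContMDiffAt.prod fun i _ ↦ hG _ _)

theorem contMDiffAt_mlieBracket [IsManifold I ∞ M] [CompleteSpace E] {x : M}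
    {X Y : Π x : M, TangentSpace I x} (hX : CMDiffAt ∞ (T% X) x) (hY : CMDiffAt ∞ (T% Y) x) :
    CMDiffAt ∞ (T% (mlieBracket I X Y)) x := by
  have : IsManifold I (minSmoothness ℝ 2) M := by
    rw [minSmoothness_of_isRCLikeNormedField]
    exact IsManifold.of_le (n := ∞) (by norm_cast)
  have : IsManifold I (((⊤ : ℕ∞) : ℕ∞ω) + 1) M := ‹IsManifold I ∞ M›
  exact ContMDiffAt.mlieBracket_vectorField (m := ⊤) (n := ⊤) hX hY
    (by rw [minSmoothness_of_isRCLikeNormedField]; exact le_rfl)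

end

variable {E : Type*} [NormedAddCommGroup E] [NormedSpace ℝ E]
  {H : Type*} [TopologicalSpace H] {I : ModelWithCorners ℝ E H}
  {M : Type*} [TopologicalSpace M] [ChartedSpace H M] [IsManifold I ∞ M]
  [RiemannianBundle (fun x : M ↦ TangentSpace I x)]
  [IsContMDiffRiemannianBundle I ∞ E (fun x : M ↦ TangentSpace I x)]

local notation "⟪" u ", " v "⟫" => inner ℝ u v

theorem contMDiffAt_inner {x : M} {X Y : Π x : M, TangentSpace I x}
    (hX : CMDiffAt ∞ (T% X) x) (hY : CMDiffAt ∞ (T% Y) x) : CMDiffAt ∞ (fun y ↦ ⟪X y, Y y⟫) x :=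
  ContMDiffAt.inner_bundle (F := E) (E := fun x : M ↦ TangentSpace I x) (b := id) hX hY

theorem contMDiffAt_koszul [CompleteSpace E] {x : M} {X Y Z : Π x : M, TangentSpace I x}
    (hX : CMDiffAt ∞ (T% X) x) (hY : CMDiffAt ∞ (T% Y) x) (hZ : CMDiffAt ∞ (T% Z) x) :
    CMDiffAt ∞ (fun y ↦ koszul X Y Z y) x := by
  unfold koszul
  have h1 := contMDiffAt_mvfderiv_apply (contMDiffAt_inner hY hZ) hX
  have h2 := contMDiffAt_mvfderiv_apply (contMDiffAt_inner hX hZ) hY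
  have h3 := contMDiffAt_mvfderiv_apply (contMDiffAt_inner hX hY) hZ
  have h4 := contMDiffAt_inner (contMDiffAt_mlieBracket hX hY) hZ
  have h5 := contMDiffAt_inner (contMDiffAt_mlieBracket hX hZ) hY
  have h6 := contMDiffAt_inner (contMDiffAt_mlieBracket hY hZ) hX
  exact contMDiffAt_const.mul (((((h1.add h2).sub h3).add h4).sub h5).sub h6)

variable [FiniteDimensional ℝ E]

/- Cramer's rule expresses the coefficients of `Z` in a local frame as quotients of smooth
functions. -/
theorem contMDiffAt_of_inner {x : M} {Z : Π x : M, TangentSpace I x}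
    (h : ∀ Y : Π x : M, TangentSpace I x, (∀ᶠ y in 𝓝 x, CMDiffAt ∞ (T% Y) y) →
      CMDiffAt ∞ (fun y ↦ ⟪Z y, Y y⟫) x) : CMDiffAt ∞ (T% Z) x := by
  let t := trivializationAt E (TangentSpace I : M → Type _) x
  have ht : t.baseSet ∈ 𝓝 x := t.open_baseSet.mem_nhds (mem_baseSet_trivializationAt E _ x)
  let b := Module.finBasis ℝ E
  let s := t.localFrame b
  have hs (i) : ∀ᶠ y in 𝓝 x, CMDiffAt ∞ (T% (s i)) y := by
    filter_upwards [ht] with y hy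
    exact contMDiffAt_localFrame_of_mem ∞ _ b i hy
  have hframe := t.isLocalFrameOn_localFrame_baseSet I ∞ b
  let G : M → Matrix (Fin (Module.finrank ℝ E)) (Fin (Module.finrank ℝ E)) ℝ :=
    fun y ↦ Matrix.gram ℝ (fun i ↦ s i y)
  have hG (i j) : CMDiffAt ∞ (fun y ↦ G y i j) x :=
    contMDiffAt_inner (hs i).self_of_nhds (hs j).self_of_nhds
  have hdet {y : M} (hy : y ∈ t.baseSet) : (G y).det ≠ 0 :=
    Matrix.det_gram_ne_zero_iff_linearIndependent.2 (hframe.linearIndependent hy)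
  refine hframe.contMDiffAt_of_coeff (fun i ↦ ?_) ht
  have hnum : CMDiffAt ∞ (fun y ↦ ((G y).updateCol i fun j ↦ ⟪Z y, s j y⟫).det) x := by
    refine contMDiffAt_det fun j k ↦ ?_
    obtain rfl | hk := eq_or_ne k i
    · simpa [Matrix.updateCol_apply] using! h _ (hs j)
    · simpa [Matrix.updateCol_apply, hk] using! hG j k
  refine (hnum.div₀ (contMDiffAt_det hG) (hdet (mem_of_mem_nhds ht))).congr_of_eventuallyEq ?_
  filter_upwards [ht] with y hy
  have hcramer := det_gram_updateCol_inner_sum (fun i ↦ s i y) (fun i ↦ hframe.coeff i y (Z y)) i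
  rw [← hframe.coeff_sum_eq Z hy] at hcramer
  exact (eq_div_iff (hdet hy)).2 ((mul_comm _ _).trans hcramer.symm)

theorem contMDiffAt_leviCivita {x : M} {X Y : Π x : M, TangentSpace I x}
    (hX : ∀ᶠ y in 𝓝 x, CMDiffAt ∞ (T% X) y) (hY : ∀ᶠ y in 𝓝 x, CMDiffAt ∞ (T% Y) y) :
    CMDiffAt ∞ (T% (fun y ↦ leviCivita I M Y y (X y))) x := by
  have : CompleteSpace E := FiniteDimensional.complete ℝ E
  refine contMDiffAt_of_inner fun Z hZ ↦ ?_
  refine (contMDiffAt_koszul hX.self_of_nhds hY.self_of_nhds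
    hZ.self_of_nhds).congr_of_eventuallyEq ?_
  filter_upwards [hX, hY, hZ] with y hX hY hZ
  exact inner_leviCivitaFun (hX.mdifferentiableAt (by simp)) (hY.mdifferentiableAt (by simp))
    (hZ.mdifferentiableAt (by simp))

end LeviCivitaSmooth

noncomputable section FormDerivative

variable {E : Type*} [NormedAddCommGroup E] [NormedSpace ℝ E]
  {H : Type*} [TopologicalSpace H] {I : ModelWithCorners ℝ E H}
  {M : Type*} [TopologicalSpace M] [ChartedSpace H M]

section Sum

variable {ι : Type} {s : Finset ι} {f : ι → M → ℝ} {x : M}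

theorem mdifferentiableAt_fun_sum (hf : ∀ i ∈ s, MDiffAt (f i) x) :
    MDiffAt (fun y ↦ ∑ i ∈ s, f i y) x := by
  simpa only [← Finset.sum_fn] using
    MDifferentiableAt.sum (I := I) (f := f) hf

theorem mdifferentiableAt_fun_prod (hf : ∀ i ∈ s, MDiffAt (f i) x) :
    MDiffAt (fun y ↦ ∏ i ∈ s, f i y) x := by
  simpa only [← Finset.prod_fn] using
    MDifferentiableAt.prod (I := I) (f := f) hf

theorem mvfderiv_fun_sum (hf : ∀ i ∈ s, MDiffAt (f i) x) :
    d% (fun y ↦ ∑ i ∈ s, f i y) x = (∑ i ∈ s, d% (f i) x : TangentSpace I x →L[ℝ] ℝ) := by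
  classical
  induction s using Finset.induction_on with
  | empty => simp [mvfderiv_const]
  | insert i s hi ih =>
    rw [Finset.forall_mem_insert] at hf
    simp only [Finset.sum_insert hi]
    rw [mvfderiv_fun_add hf.1 (mdifferentiableAt_fun_sum hf.2), ih hf.2]

end Sum

variable {k : ℕ}

theorem update_field_apply (V : Fin k → Π y : M, TangentSpace I y) (i : Fin k)
    (σ : Π y : M, TangentSpace I y) (y : M) :
    (fun j ↦ Function.update V i σ j y) = Function.update (fun j ↦ V j y) i (σ y) :=
  funext fun j ↦ Function.apply_update (fun _ σ ↦ σ y) V i σ j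

variable [FiniteDimensional ℝ E] [IsManifold I ∞ M]

/-- A field of `k`-linear forms is smooth if it takes smooth vector fields to smooth functions. -/
def IsSmoothForm (φ : Π y : M, (Fin k → TangentSpace I y) → ℝ) : Prop :=
  ∀ (y : M) (V : Fin k → Π z : M, TangentSpace I z), (∀ i, CMDiffAt ∞ (T% (V i)) y) →
    CMDiffAt ∞ (fun z ↦ φ z fun i ↦ V i z) y

theorem mdifferentiableAt_form {φ : Π y : M, MultilinearMap ℝ (fun _ : Fin k ↦ TangentSpace I y) ℝ}
    (hφ : IsSmoothForm fun y ↦ φ y) {x : M} {V : Fin k → Π y : M, TangentSpace I y}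
    (hV : ∀ i, MDiffAt (T% (V i)) x) : MDiffAt (fun y ↦ φ y fun i ↦ V i y) x := by
  let t := trivializationAt E (TangentSpace I : M → Type _) x
  have hx : x ∈ t.baseSet := mem_baseSet_trivializationAt E (TangentSpace I : M → Type _) x
  let b := Module.finBasis ℝ E
  let s := t.localFrame b
  let c := t.localFrameCoeff I b
  have hs (i) : CMDiffAt ∞ (T% (s i)) x := contMDiffAt_localFrame_of_mem ∞ _ b i hx
  have hsum : MDiffAt (fun y ↦ ∑ r : Fin k → Fin (Module.finrank ℝ E),
      (∏ i, c (r i) y (V i y)) * φ y fun i ↦ s (r i) y) x :=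
    mdifferentiableAt_fun_sum fun r _ ↦
      (mdifferentiableAt_fun_prod fun i _ ↦ mdifferentiableAt_localFrameCoeff b hx (hV i) (r i)).mul
        ((hφ x (fun i ↦ s (r i)) fun i ↦ hs (r i)).mdifferentiableAt (by simp))
  refine hsum.congr_of_eventuallyEq ?_
  filter_upwards [t.open_baseSet.mem_nhds hx] with y hy
  have hexpand : (fun i ↦ V i y) = fun i ↦ ∑ j, c j y (V i y) • s j y :=
    funext fun i ↦ t.eq_sum_localFrameCoeff_smul (I := I) (b := b) (s := V i) hy
  conv_lhs => rw [hexpand]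
  rw [MultilinearMap.map_sum]
  exact Finset.sum_congr rfl fun r _ ↦ by rw [MultilinearMap.map_smul_univ, smul_eq_mul]

variable [RiemannianBundle (fun x : M ↦ TangentSpace I x)]
  [IsContMDiffRiemannianBundle I ∞ E (fun x : M ↦ TangentSpace I x)] {x : M}

/-- `u(φ(V₁, …, V_k)) - ∑ᵢ φ(V₁, …, ∇_u Vᵢ, …, V_k)` for vector fields `Vᵢ`. -/
def formDeriv (φ : Π y : M, (Fin k → TangentSpace I y) → ℝ) (x : M) (u : TangentSpace I x)
    (V : Fin k → Π y : M, TangentSpace I y) : ℝ :=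
  d% (fun y ↦ φ y (fun i ↦ V i y)) x u
    - ∑ i, φ x (Function.update (fun j ↦ V j x) i (leviCivita I M (V i) x u))

theorem covDerivForm_eq_formDeriv (φ : Π y : M, (Fin k → TangentSpace I y) → ℝ)
    (u : TangentSpace I x) (v : Fin k → TangentSpace I x) :
    covDerivForm φ x u v = formDeriv φ x u (fun i ↦ extend E (v i)) := by
  simp only [covDerivForm, formDeriv, extend_apply_self]

theorem sum_update_leviCivita_update (φ : (Fin k → TangentSpace I x) → ℝ) (u : TangentSpace I x)
    (V : Fin k → Π y : M, TangentSpace I y) (i : Fin k) (σ : Π y : M, TangentSpace I y) :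
    ∑ j, φ (Function.update (fun l ↦ Function.update V i σ l x) j
        (leviCivita I M (Function.update V i σ j) x u)) =
      φ (Function.update (fun l ↦ V l x) i (leviCivita I M σ x u))
      + ∑ j ∈ Finset.univ.erase i, φ (Function.update (Function.update (fun l ↦ V l x) j
          (leviCivita I M (V j) x u)) i (σ x)) := by
  rw [← Finset.add_sum_erase _ _ (Finset.mem_univ i)]
  simp only [update_field_apply, Function.update_self, Function.update_idem]
  congr 1
  refine Finset.sum_congr rfl fun j hj ↦ ?_
  have hji : j ≠ i := Finset.ne_of_mem_erase hj
  rw [Function.update_of_ne hji, Function.update_comm hji.symm]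

theorem formDeriv_update (φ : Π y : M, (Fin k → TangentSpace I y) → ℝ) (u : TangentSpace I x)
    (V : Fin k → Π y : M, TangentSpace I y) (i : Fin k) (σ : Π y : M, TangentSpace I y) :
    formDeriv φ x u (Function.update V i σ) =
      d% (fun y ↦ φ y (Function.update (fun j ↦ V j y) i (σ y))) x u
      - (φ x (Function.update (fun j ↦ V j x) i (leviCivita I M σ x u))
      + ∑ j ∈ Finset.univ.erase i, φ x (Function.update (Function.update (fun j ↦ V j x) j
          (leviCivita I M (V j) x u)) i (σ x))) := by
  rw [formDeriv, sum_update_leviCivita_update]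
  simp only [update_field_apply]

variable {φ : Π y : M, MultilinearMap ℝ (fun _ : Fin k ↦ TangentSpace I y) ℝ}
  (hφ : IsSmoothForm fun y ↦ φ y) (u : TangentSpace I x)
include hφ

theorem formDeriv_tensorialAt {V : Fin k → Π y : M, TangentSpace I y}
    (hV : ∀ i, MDiffAt (T% (V i)) x) (i : Fin k) :
    TensorialAt I E (fun σ ↦ formDeriv (fun y ↦ φ y) x u (Function.update V i σ)) x := by
  have hd {σ : Π y : M, TangentSpace I y} (hσ : MDiffAt (T% σ) x) :
      MDiffAt (fun y ↦ φ y (Function.update (fun j ↦ V j y) i (σ y))) x := by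
    have := mdifferentiableAt_form hφ (V := Function.update V i σ) fun j ↦ by
      obtain rfl | h := eq_or_ne j i
      · simpa using hσ
      · simpa [h] using hV j
    simpa only [update_field_apply] using this
  constructor
  · intro f σ hf hσ
    simp only [formDeriv_update, Pi.smul_apply', MultilinearMap.map_update_smul, smul_eq_mul]
    rw [mvfderiv_fun_mul hf (hd hσ), (leviCivita I M).isCovariantDerivativeOn.leibniz hσ hf]
    simp [MultilinearMap.map_update_add, MultilinearMap.map_update_smul, ← Finset.mul_sum]
    ring
  · intro σ σ' hσ hσ'
    simp only [formDeriv_update, Pi.add_apply, MultilinearMap.map_update_add]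
    rw [mvfderiv_fun_add (hd hσ) (hd hσ'), (leviCivita I M).isCovariantDerivativeOn.add hσ hσ']
    simp [MultilinearMap.map_update_add, Finset.sum_add_distrib]
    ring

theorem formDeriv_congr {V V' : Fin k → Π y : M, TangentSpace I y}
    (hV : ∀ i, MDiffAt (T% (V i)) x) (hV' : ∀ i, MDiffAt (T% (V' i)) x)
    (h : ∀ i, V i x = V' i x) :
    formDeriv (fun y ↦ φ y) x u V = formDeriv (fun y ↦ φ y) x u V' := by
  suffices H : ∀ s : Finset (Fin k),
      formDeriv (fun y ↦ φ y) x u V = formDeriv (fun y ↦ φ y) x u (s.piecewise V' V) by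
    simpa using H Finset.univ
  intro s
  induction s using Finset.induction_on with
  | empty => simp
  | insert j s hj ih =>
    have hP (i) : MDiffAt (T% (s.piecewise V' V i)) x := by
      by_cases hi : i ∈ s
      · simpa [hi] using hV' i
      · simpa [hi] using hV i
    rw [ih, Finset.piecewise_insert]
    conv_lhs => rw [← Function.update_eq_self j (s.piecewise V' V)]
    refine (formDeriv_tensorialAt hφ u hP j).pointwise (hP j) (hV' j) ?_
    simp [hj, h]

theorem mvfderiv_form {V : Fin k → Π y : M, TangentSpace I y} (hV : ∀ i, MDiffAt (T% (V i)) x) :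
    d% (fun y ↦ φ y (fun i ↦ V i y)) x u =
      ∑ i, φ x (Function.update (fun j ↦ V j x) i (leviCivita I M (V i) x u))
      + covDerivForm (fun y ↦ φ y) x u (fun i ↦ V i x) := by
  rw [covDerivForm_eq_formDeriv, ← formDeriv_congr hφ u hV
    (fun i ↦ mdifferentiableAt_extend I E (V i x)) (fun i ↦ by simp), formDeriv]
  ring

end FormDerivative

noncomputable section RicciIdentity

variable {E : Type*} [NormedAddCommGroup E] [NormedSpace ℝ E] [FiniteDimensional ℝ E]
  {H : Type*} [TopologicalSpace H] {I : ModelWithCorners ℝ E H}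
  {M : Type*} [TopologicalSpace M] [ChartedSpace H M] [IsManifold I ∞ M]

local notation "⟪" u ", " v "⟫" => inner ℝ u v

/-- The vector field `X` is smooth in a neighbourhood of `x`. -/
def SmoothNear (x : M) (X : Π y : M, TangentSpace I y) : Prop :=
  ∀ᶠ y in 𝓝 x, CMDiffAt ∞ (T% X) y

namespace SmoothNear

variable {x : M} {X Y : Π y : M, TangentSpace I y}

omit [FiniteDimensional ℝ E] in
theorem contMDiffAt (h : SmoothNear x X) : CMDiffAt ∞ (T% X) x := h.self_of_nhds

omit [FiniteDimensional ℝ E] in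
theorem mdifferentiableAt (h : SmoothNear x X) : MDiffAt (T% X) x :=
  h.contMDiffAt.mdifferentiableAt (by simp)

omit [FiniteDimensional ℝ E] in
theorem extend (u : TangentSpace I x) : SmoothNear x (extend E u) :=
  eventually_contMDiffAt_extend u

omit [FiniteDimensional ℝ E] in
theorem update {k : ℕ} {V : Fin k → Π y : M, TangentSpace I y} (hV : ∀ i, SmoothNear x (V i))
    (hX : SmoothNear x X) (i j : Fin k) : SmoothNear x (Function.update V i X j) := by
  obtain rfl | h := eq_or_ne j i
  · simpa using hX
  · simpa [h] using hV j

variable [RiemannianBundle (fun x : M ↦ TangentSpace I x)]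
  [IsContMDiffRiemannianBundle I ∞ E (fun x : M ↦ TangentSpace I x)]

theorem leviCivita (hX : SmoothNear x X) (hY : SmoothNear x Y) :
    SmoothNear x (fun y ↦ leviCivita I M Y y (X y)) := by
  filter_upwards [hX.eventually_nhds, hY.eventually_nhds] with y hX hY
  exact contMDiffAt_leviCivita hX hY

end SmoothNear

variable [RiemannianBundle (fun x : M ↦ TangentSpace I x)]
  [IsContMDiffRiemannianBundle I ∞ E (fun x : M ↦ TangentSpace I x)] {x : M}

section Curvature

/-- `∇_U A` for the local extension `U` of the tangent vector `u`. -/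
def nablaExtend (u : TangentSpace I x) (A : Π y : M, TangentSpace I y) :
    Π y : M, TangentSpace I y :=
  fun y ↦ leviCivita I M A y ((extend E u : Π y : M, TangentSpace I y) y)

theorem SmoothNear.nablaExtend (u : TangentSpace I x) {A : Π y : M, TangentSpace I y}
    (hA : SmoothNear x A) : SmoothNear x (nablaExtend u A) :=
  (SmoothNear.extend u).leviCivita hA

theorem nablaExtend_apply_self (u : TangentSpace I x) (A : Π y : M, TangentSpace I y) :
    nablaExtend u A x = leviCivita I M A x u := by
  rw [nablaExtend, extend_apply_self]

theorem leviCivita_congr {X Y : Π y : M, TangentSpace I y} (hX : MDiffAt (T% X) x)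
    (hY : MDiffAt (T% Y) x) (h : X =ᶠ[𝓝 x] Y) : leviCivita I M X x = leviCivita I M Y x :=
  (leviCivita I M).isCovariantDerivativeOn.congr_of_eventuallyEq hX hY Filter.univ_mem h

variable [I.Boundaryless]

theorem nablaExtend_extend_comm (u v : TangentSpace I x) :
    nablaExtend u (extend E v) =ᶠ[𝓝 x] nablaExtend v (extend E u) := by
  have : CompleteSpace E := FiniteDimensional.complete ℝ E
  filter_upwards [extChartAt_source_mem_nhds (I := I) x,
    SmoothNear.extend u, SmoothNear.extend v] with y hy hu hv
  have h := (CovariantDerivative.torsion_eq_zero_iff (leviCivita I M)).1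
    (leviCivita_torsion (I := I) (M := M))
    (hu.mdifferentiableAt (by simp)) (hv.mdifferentiableAt (by simp))
  rwa [mlieBracket_extend u v hy, sub_eq_zero] at h

theorem curvature_eq (u v w : TangentSpace I x) :
    curvature I M x u v w = leviCivita I M (nablaExtend u (extend E w)) x v
      - leviCivita I M (nablaExtend v (extend E w)) x u := by
  have : CompleteSpace E := FiniteDimensional.complete ℝ E
  simp only [curvature, mlieBracket_extend u v (mem_extChartAt_source x), map_zero, zero_sub,
    neg_sub]
  rfl

theorem curvature_swap (u v w : TangentSpace I x) :
    curvature I M x u v w = -curvature I M x v u w := by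
  rw [curvature_eq, curvature_eq, neg_sub]

theorem curvature_bianchi (u v w : TangentSpace I x) :
    curvature I M x u v w + curvature I M x v w u + curvature I M x w u v = 0 := by
  have hcomm (a b : TangentSpace I x) :
      leviCivita I M (nablaExtend a (extend E b)) x =
        leviCivita I M (nablaExtend b (extend E a)) x :=
    leviCivita_congr ((SmoothNear.extend b).nablaExtend a).mdifferentiableAt
      ((SmoothNear.extend a).nablaExtend b).mdifferentiableAt (nablaExtend_extend_comm a b)
  rw [curvature_eq, curvature_eq, curvature_eq, hcomm u w, hcomm v u, hcomm w v]
  abel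

end Curvature

variable {k : ℕ}

/-- `χ` is the covariant derivative of the field `φ` of `k`-linear forms, the direction of
differentiation being the first argument of `χ`. -/
structure HasCovDeriv (φ : Π y : M, (Fin k → TangentSpace I y) → ℝ)
    (χ : Π y : M, (Fin (k + 1) → TangentSpace I y) → ℝ) : Prop where
  mdifferentiableAt (y : M) (V : Fin k → Π z : M, TangentSpace I z)
    (hV : ∀ i, CMDiffAt ∞ (T% (V i)) y) : MDiffAt (fun z ↦ φ z fun i ↦ V i z) y
  mvfderiv_eq (y : M) (V : Fin k → Π z : M, TangentSpace I z)
    (hV : ∀ i, CMDiffAt ∞ (T% (V i)) y) (u : TangentSpace I y) :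
    d% (fun z ↦ φ z fun i ↦ V i z) y u =
      ∑ i, φ y (Function.update (fun j ↦ V j y) i (leviCivita I M (V i) y u))
      + χ y (Matrix.vecCons u fun i ↦ V i y)

theorem IsSmoothForm.hasCovDeriv
    {φ : Π y : M, MultilinearMap ℝ (fun _ : Fin k ↦ TangentSpace I y) ℝ}
    (hφ : IsSmoothForm fun y ↦ φ y) :
    HasCovDeriv (fun y ↦ φ y) fun y v ↦ covDerivForm (fun y ↦ φ y) y (v 0) (Matrix.vecTail v) where
  mdifferentiableAt y V hV := (hφ y V hV).mdifferentiableAt (by simp)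
  mvfderiv_eq y V hV u := mvfderiv_form hφ u fun i ↦ (hV i).mdifferentiableAt (by simp)

namespace HasCovDeriv

variable {φ φ' : Π y : M, (Fin k → TangentSpace I y) → ℝ}
  {χ χ' : Π y : M, (Fin (k + 1) → TangentSpace I y) → ℝ}

theorem contMDiffAt (hφ : HasCovDeriv φ χ) (hs : IsSmoothForm φ) {U : Π y : M, TangentSpace I y}
    {V : Fin k → Π y : M, TangentSpace I y} (hU : SmoothNear x U) (hV : ∀ i, SmoothNear x (V i)) :
    CMDiffAt ∞ (fun y ↦ χ y (Matrix.vecCons (U y) fun i ↦ V i y)) x := by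
  let W (i) := Function.update V i fun y ↦ leviCivita I M (V i) y (U y)
  have hd : CMDiffAt ∞ (fun y ↦ d% (fun z ↦ φ z fun i ↦ V i z) y (U y)) x :=
    contMDiffAt_mvfderiv_apply (hs x V fun i ↦ (hV i).contMDiffAt) hU.contMDiffAt
  have hW : CMDiffAt ∞ (fun y ↦ ∑ i, φ y fun j ↦ W i j y) x :=
    .sum fun i _ ↦ hs x (W i) fun j ↦ (SmoothNear.update hV (hU.leviCivita (hV i)) i j).contMDiffAt
  refine (hd.sub hW).congr_of_eventuallyEq ?_
  filter_upwards [Filter.eventually_all.2 hV] with y hV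
  simp only [W, update_field_apply, hφ.mvfderiv_eq y V hV (U y), add_sub_cancel_left]

theorem congr (hφ : HasCovDeriv φ χ) (h : ∀ y v, χ y v = χ' y v) : HasCovDeriv φ χ' := by
  obtain rfl : χ = χ' := funext fun y ↦ funext (h y)
  exact hφ

theorem add (hφ : HasCovDeriv φ χ) (hφ' : HasCovDeriv φ' χ') :
    HasCovDeriv (fun y v ↦ φ y v + φ' y v) fun y v ↦ χ y v + χ' y v where
  mdifferentiableAt y V hV := (hφ.mdifferentiableAt y V hV).add (hφ'.mdifferentiableAt y V hV)
  mvfderiv_eq y V hV u := by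
    rw [mvfderiv_fun_add (hφ.mdifferentiableAt y V hV) (hφ'.mdifferentiableAt y V hV), add_apply,
      hφ.mvfderiv_eq y V hV, hφ'.mvfderiv_eq y V hV, Finset.sum_add_distrib]
    ring

theorem fun_mul {f : M → ℝ} (hf : ∀ y, MDiffAt f y) (hφ : HasCovDeriv φ χ) :
    HasCovDeriv (fun y v ↦ f y * φ y v)
      fun y v ↦ f y * χ y v + φ y (Matrix.vecTail v) * d% f y (v 0) where
  mdifferentiableAt y V hV := (hf y).mul (hφ.mdifferentiableAt y V hV)
  mvfderiv_eq y V hV u := by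
    rw [mvfderiv_fun_mul (hf y) (hφ.mdifferentiableAt y V hV), add_apply, smul_apply, smul_apply,
      hφ.mvfderiv_eq y V hV, smul_eq_mul, smul_eq_mul, mul_add, Finset.mul_sum]
    simp only [Matrix.tail_cons, Matrix.cons_val_zero]
    ring

end HasCovDeriv

section RicciIdentity

variable {φ : Π y : M, MultilinearMap ℝ (fun _ : Fin k ↦ TangentSpace I y) ℝ}
  {χ : Π y : M, (Fin (k + 1) → TangentSpace I y) → ℝ}
  {κ : Π y : M, (Fin (k + 2) → TangentSpace I y) → ℝ}

/-- The part of the second derivative of `φ(A₁, …, A_k)` in which two different arguments are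
differentiated. -/
def mixedDeriv (φ : (Fin k → TangentSpace I x) → ℝ) (A : Fin k → Π y : M, TangentSpace I y)
    (u v : TangentSpace I x) : ℝ :=
  ∑ i, ∑ j ∈ Finset.univ.erase i, φ (Function.update (Function.update (fun l ↦ A l x) j
    (leviCivita I M (A j) x u)) i (leviCivita I M (A i) x v))

theorem mixedDeriv_comm (φ : (Fin k → TangentSpace I x) → ℝ)
    (A : Fin k → Π y : M, TangentSpace I y) (u v : TangentSpace I x) :
    mixedDeriv φ A u v = mixedDeriv φ A v u := by
  rw [mixedDeriv, mixedDeriv, Finset.sum_comm' (t' := Finset.univ)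
    (s' := fun j ↦ Finset.univ.erase j) (by simp [ne_comm])]
  exact Finset.sum_congr rfl fun j _ ↦ Finset.sum_congr rfl fun i hi ↦
    congrArg φ (Function.update_comm (Finset.ne_of_mem_erase hi).symm _ _ _)

omit [FiniteDimensional ℝ E] [IsManifold I ∞ M]
  [RiemannianBundle (fun x : M ↦ TangentSpace I x)]
  [IsContMDiffRiemannianBundle I ∞ E (fun x : M ↦ TangentSpace I x)] in
theorem vecCons_field_apply (B : Π y : M, TangentSpace I y) (A : Fin k → Π y : M, TangentSpace I y)
    (y : M) : (fun j ↦ Matrix.vecCons B A j y) = Matrix.vecCons (B y) fun i ↦ A i y :=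
  funext fun j ↦ Fin.cases rfl (fun _ ↦ rfl) j

theorem sum_update_vecCons (χ : (Fin (k + 1) → TangentSpace I x) → ℝ) (u : TangentSpace I x)
    (B : Π y : M, TangentSpace I y) (A : Fin k → Π y : M, TangentSpace I y) :
    ∑ j, χ (Function.update (fun l ↦ Matrix.vecCons B A l x) j
        (leviCivita I M (Matrix.vecCons B A j) x u)) =
      χ (Matrix.vecCons (leviCivita I M B x u) fun l ↦ A l x)
      + ∑ j, χ (Matrix.vecCons (B x)
          (Function.update (fun l ↦ A l x) j (leviCivita I M (A j) x u))) := by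
  rw [Fin.sum_univ_succ, vecCons_field_apply]
  congr 1
  · exact congrArg χ (Fin.update_cons_zero (α := fun _ ↦ TangentSpace I x) _ _ _)
  · exact Finset.sum_congr rfl fun j _ ↦
      congrArg χ (Fin.cons_update (α := fun _ ↦ TangentSpace I x) _ _ _ _).symm

/- Differentiate the Leibniz rule for `v(φ(A₁, …, A_k))` once more in the direction `u`. -/
theorem HasCovDeriv.mvfderiv_mvfderiv_extend (hφ : HasCovDeriv (fun y ↦ φ y) χ)
    (hχ : HasCovDeriv χ κ) {A : Fin k → Π y : M, TangentSpace I y}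
    (hA : ∀ i, SmoothNear x (A i)) (u v : TangentSpace I x) :
    d% (fun y ↦ d% (fun z ↦ φ z fun i ↦ A i z) y
        ((extend E v : Π y : M, TangentSpace I y) y)) x u =
      ∑ i, φ x (Function.update (fun l ↦ A l x) i (leviCivita I M (nablaExtend v (A i)) x u))
      + mixedDeriv (φ x) A u v
      + ∑ i, χ x (Matrix.vecCons u
          (Function.update (fun l ↦ A l x) i (leviCivita I M (A i) x v)))
      + ∑ i, χ x (Matrix.vecCons v
          (Function.update (fun l ↦ A l x) i (leviCivita I M (A i) x u)))
      + χ x (Matrix.vecCons (nablaExtend u (extend E v) x) fun l ↦ A l x)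
      + κ x (Matrix.vecCons u (Matrix.vecCons v fun l ↦ A l x)) := by
  let V (i) := Function.update A i (nablaExtend v (A i))
  let W : Fin (k + 1) → Π y : M, TangentSpace I y := Matrix.vecCons (extend E v) A
  have hV (i j) : CMDiffAt ∞ (T% (V i j)) x :=
    (SmoothNear.update hA ((hA i).nablaExtend v) i j).contMDiffAt
  have hW (j) : CMDiffAt ∞ (T% (W j)) x :=
    Fin.cases (SmoothNear.extend v).contMDiffAt (fun i ↦ (hA i).contMDiffAt) j
  have hleibniz : (fun y ↦ d% (fun z ↦ φ z fun i ↦ A i z) y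
      ((extend E v : Π y : M, TangentSpace I y) y)) =ᶠ[𝓝 x]
      fun y ↦ (∑ i, φ y fun j ↦ V i j y) + χ y fun j ↦ W j y := by
    filter_upwards [Filter.eventually_all.2 hA] with y hA
    rw [hφ.mvfderiv_eq y A hA]
    congr 1
    · exact Finset.sum_congr rfl fun i _ ↦ by rw [update_field_apply]; rfl
    · rw [vecCons_field_apply]
  have hdV (i) (_ : i ∈ Finset.univ) := hφ.mdifferentiableAt x (V i) (hV i)
  rw [mvfderiv_congr_of_eventuallyEq hleibniz,
    mvfderiv_fun_add (mdifferentiableAt_fun_sum hdV) (hχ.mdifferentiableAt x W hW),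
    mvfderiv_fun_sum hdV]
  rw [add_apply, sum_apply, hχ.mvfderiv_eq x W hW,
    Finset.sum_congr rfl fun i _ ↦ hφ.mvfderiv_eq x (V i) (hV i) u]
  simp only [V, W, sum_update_leviCivita_update, sum_update_vecCons]
  simp only [update_field_apply, vecCons_field_apply, extend_apply_self, nablaExtend_apply_self,
    Finset.sum_add_distrib, mixedDeriv]
  ring

theorem HasCovDeriv.ricci_identity [I.Boundaryless] (hs : IsSmoothForm fun y ↦ φ y)
    (hφ : HasCovDeriv (fun y ↦ φ y) χ) (hχ : HasCovDeriv χ κ) (u v : TangentSpace I x)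
    (a : Fin k → TangentSpace I x) :
    ∑ i, φ x (Function.update a i (curvature I M x u v (a i))) =
      κ x (Matrix.vecCons u (Matrix.vecCons v a))
      - κ x (Matrix.vecCons v (Matrix.vecCons u a)) := by
  let A (i : Fin k) : Π y : M, TangentSpace I y := extend E (a i)
  have hA (i) : SmoothNear x (A i) := SmoothNear.extend (a i)
  have hAx : (fun i ↦ A i x) = a := funext fun i ↦ extend_apply_self E (a i)
  have hcomm := mvfderiv_extend_comm (f := fun z ↦ φ z fun i ↦ A i z)
    ((Filter.eventually_all.2 hA).mono fun y hA ↦ hs y A hA) u v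
  rw [hφ.mvfderiv_mvfderiv_extend hχ hA, hφ.mvfderiv_mvfderiv_extend hχ hA, mixedDeriv_comm,
    (nablaExtend_extend_comm u v).self_of_nhds, hAx] at hcomm
  simp only [curvature_eq, MultilinearMap.map_update_sub, Finset.sum_sub_distrib]
  linarith

end RicciIdentity

theorem mvfderiv_inner {Y Z : Π x : M, TangentSpace I x} (hY : MDiffAt (T% Y) x)
    (hZ : MDiffAt (T% Z) x) (u : TangentSpace I x) :
    d% (fun y ↦ ⟪Y y, Z y⟫) x u =
      ⟪leviCivita I M Y x u, Z x⟫ + ⟪Y x, leviCivita I M Z x u⟫ := by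
  have := leviCivita_metric (mdifferentiableAt_extend I E u) hY hZ
  simpa only [extend_apply_self] using this

/-- A bilinear form as a multilinear map of two arguments. -/
def bilinToMultilinear {V : Type*} [AddCommGroup V] [Module ℝ V] (B : V →ₗ[ℝ] V →ₗ[ℝ] ℝ) :
    MultilinearMap ℝ (fun _ : Fin 2 ↦ V) ℝ where
  toFun v := B (v 0) (v 1)
  map_update_add' v i a b := by fin_cases i <;> simp
  map_update_smul' v i r a := by fin_cases i <;> simp

variable (I M) in
omit [FiniteDimensional ℝ E] in
theorem isSmoothForm_inner :
    IsSmoothForm fun (y : M) (v : Fin 2 → TangentSpace I y) ↦ ⟪v 0, v 1⟫ :=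
  fun _ _ hV ↦ contMDiffAt_inner (hV 0) (hV 1)

variable (I M) in
theorem hasCovDeriv_inner :
    HasCovDeriv (fun (y : M) (v : Fin 2 → TangentSpace I y) ↦ ⟪v 0, v 1⟫) 0 where
  mdifferentiableAt y V hV := (isSmoothForm_inner I M y V hV).mdifferentiableAt (by simp)
  mvfderiv_eq y V hV u := by
    have hd (i) := (hV i).mdifferentiableAt (n := ∞) (by simp)
    refine (mvfderiv_inner (hd 0) (hd 1) u).trans ?_
    simp

theorem inner_curvature_skew [I.Boundaryless] (u v a b : TangentSpace I x) :
    ⟪curvature I M x u v a, b⟫ = -⟪curvature I M x u v b, a⟫ := by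
  let g (y : M) := bilinToMultilinear (innerₗ (TangentSpace I y))
  have hg : HasCovDeriv (I := I) (fun y ↦ g y) 0 := hasCovDeriv_inner I M
  have h0 : HasCovDeriv (I := I) (M := M) (k := 3) 0 0 :=
    { mdifferentiableAt := fun y V _ ↦ mdifferentiableAt_const
      mvfderiv_eq := fun y V _ w ↦ by simp [mvfderiv_const] }
  have hsum : ⟪curvature I M x u v a, b⟫ + ⟪a, curvature I M x u v b⟫ = 0 := by
    simpa [g, bilinToMultilinear] using
      hg.ricci_identity (isSmoothForm_inner I M) h0 u v ![a, b]
  rwa [eq_neg_iff_add_eq_zero, real_inner_comm a]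

end RicciIdentity

noncomputable section HermitianAlgebra

local notation "⟪" u ", " v "⟫" => inner ℝ u v

variable {V : Type*} [NormedAddCommGroup V] [InnerProductSpace ℝ V] {n : ℕ}

theorem exists_unit_orthogonal [FiniteDimensional ℝ V] {ι : Type*} [Fintype ι]
    (hn : Fintype.card ι < Module.finrank ℝ V) (f : ι → V) :
    ∃ e : V, ‖e‖ = 1 ∧ ∀ i, ⟪f i, e⟫ = 0 := by
  set W := Submodule.span ℝ (Set.range f)
  have hW : Module.finrank ℝ W < Module.finrank ℝ V := (finrank_range_le_card f).trans_lt hn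
  have hpos : 0 < Module.finrank ℝ Wᗮ := by have := W.finrank_add_finrank_orthogonal; omega
  have : Nontrivial Wᗮ := Module.finrank_pos_iff.1 hpos
  obtain ⟨w, hw⟩ := exists_ne (0 : Wᗮ)
  have hw : ‖(w : V)‖ ≠ 0 := by simpa using hw
  refine ⟨‖(w : V)‖⁻¹ • (w : V), ?_, fun i ↦ ?_⟩
  · rw [norm_smul, norm_inv, norm_norm, inv_mul_cancel₀ hw]
  · rw [inner_smul_right, (W.mem_orthogonal _).1 w.2 _ (Submodule.subset_span ⟨i, rfl⟩), mul_zero]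

/-- `J` is an orthogonal complex structure on `V`. -/
structure IsOrthogonalComplexStructure (J : V →ₗ[ℝ] V) : Prop where
  J_J : ∀ u, J (J u) = -u
  inner_J_J : ∀ u v, ⟪J u, J v⟫ = ⟪u, v⟫

/-- `e` is orthonormal for the Hermitian product `⟪·, ·⟫ + i ⟪·, J ·⟫`. -/
structure IsUnitaryFrame (J : V →ₗ[ℝ] V) (e : Fin n → V) : Prop where
  inner_eq : ∀ i j, ⟪e i, e j⟫ = if i = j then 1 else 0
  inner_J_eq : ∀ i j, ⟪e i, J (e j)⟫ = 0

/-- Real linear coordinates `V ≃ ℂⁿ` carrying `J` to `i` and the metric of `V` to that of `ℂⁿ`. -/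
structure IsUnitaryCoord (J : V →ₗ[ℝ] V) (c : V ≃ₗ[ℝ] (Fin n → ℂ)) : Prop where
  map_J : ∀ u k, c (J u) k = Complex.I * c u k
  inner_eq : ∀ u v, ⟪u, v⟫ = ∑ k, ((c u k).re * (c v k).re + (c u k).im * (c v k).im)

namespace IsOrthogonalComplexStructure

variable {J : V →ₗ[ℝ] V}

theorem inner_J_left (hJ : IsOrthogonalComplexStructure J) (u v : V) : ⟪J u, v⟫ = -⟪u, J v⟫ := by
  rw [← hJ.inner_J_J u (J v), hJ.J_J, inner_neg_right, neg_neg]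

theorem inner_J_self (hJ : IsOrthogonalComplexStructure J) (u : V) : ⟪u, J u⟫ = 0 := by
  have := hJ.inner_J_left u u
  rw [real_inner_comm] at this
  linarith

theorem isUnitaryFrame_cons (hJ : IsOrthogonalComplexStructure J) {e : Fin n → V}
    (he : IsUnitaryFrame J e) {a : V} (ha : ‖a‖ = 1) (hea : ∀ i, ⟪e i, a⟫ = 0)
    (hJa : ∀ i, ⟪J (e i), a⟫ = 0) : IsUnitaryFrame J (Fin.cons a e : Fin (n + 1) → V) where
  inner_eq i j := by
    have hae (i) : ⟪a, e i⟫ = 0 := by rw [real_inner_comm, hea]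
    cases i using Fin.cases <;> cases j using Fin.cases <;>
      simp [ha, hae, hea, he.inner_eq, Fin.succ_ne_zero, (Fin.succ_ne_zero _).symm]
  inner_J_eq i j := by
    have haJ (i) : ⟪e i, J a⟫ = 0 := by rw [← neg_eq_zero, ← hJ.inner_J_left, hJa]
    cases i using Fin.cases <;> cases j using Fin.cases <;>
      simp [haJ, hJa, hJ.inner_J_self, he.inner_J_eq, real_inner_comm (J _) a]

theorem exists_isUnitaryFrame [FiniteDimensional ℝ V] (hJ : IsOrthogonalComplexStructure J)
    (hn : 2 * n ≤ Module.finrank ℝ V) : ∃ e : Fin n → V, IsUnitaryFrame J e := by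
  induction n with
  | zero => exact ⟨Fin.elim0, ⟨fun i ↦ i.elim0, fun i ↦ i.elim0⟩⟩
  | succ n ih =>
    obtain ⟨e, he⟩ := ih (by omega)
    obtain ⟨a, ha, hea⟩ := exists_unit_orthogonal (ι := Fin n ⊕ Fin n)
      (by simp only [Fintype.card_sum, Fintype.card_fin]; omega) (Sum.elim e (J ∘ e))
    exact ⟨_, hJ.isUnitaryFrame_cons he ha (fun i ↦ hea (.inl i)) fun i ↦ hea (.inr i)⟩

end IsOrthogonalComplexStructure

namespace IsUnitaryFrame

variable {J : V →ₗ[ℝ] V} {e : Fin n → V}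

theorem orthonormal (he : IsUnitaryFrame J e) (hJ : IsOrthogonalComplexStructure J) :
    Orthonormal ℝ (Sum.elim e (J ∘ e)) := by
  rw [orthonormal_iff_ite]
  rintro (i | i) (j | j) <;>
    simp [he.inner_eq, he.inner_J_eq, hJ.inner_J_left, hJ.J_J]

theorem exists_orthonormalBasis [FiniteDimensional ℝ V] (he : IsUnitaryFrame J e)
    (hJ : IsOrthogonalComplexStructure J) (hV : Module.finrank ℝ V = 2 * n) :
    ∃ b : OrthonormalBasis (Fin n ⊕ Fin n) ℝ V, ⇑b = Sum.elim e (J ∘ e) := by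
  have hb := he.orthonormal hJ
  have hcard : Fintype.card (Fin n ⊕ Fin n) = Module.finrank ℝ V := by simp [hV, two_mul]
  exact ⟨.mk hb (hb.linearIndependent.span_eq_top_of_card_eq_finrank' hcard).ge, by simp⟩

/-- The complex coordinates `⟪eₖ, v⟫ + i ⟪J eₖ, v⟫` of a vector in a unitary frame. -/
def coord (J : V →ₗ[ℝ] V) (e : Fin n → V) : V →ₗ[ℝ] (Fin n → ℂ) :=
  LinearMap.pi fun k ↦ Complex.equivRealProdLm.symm.toLinearMap ∘ₗ
    ((innerₗ V (e k)).prod (innerₗ V (J (e k))))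

theorem coord_apply (v : V) (k : Fin n) : coord J e v k = ⟨⟪e k, v⟫, ⟪J (e k), v⟫⟩ := rfl

theorem inner_eq_sum_coord [FiniteDimensional ℝ V] (he : IsUnitaryFrame J e)
    (hJ : IsOrthogonalComplexStructure J) (hV : Module.finrank ℝ V = 2 * n) (u v : V) :
    ⟪u, v⟫ = ∑ k, ((coord J e u k).re * (coord J e v k).re
      + (coord J e u k).im * (coord J e v k).im) := by
  obtain ⟨b, hb⟩ := he.exists_orthonormalBasis hJ hV
  simp [← b.sum_inner_mul_inner u v, Fintype.sum_sum_type, Finset.sum_add_distrib, hb,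
    coord_apply, real_inner_comm u]

theorem exists_isUnitaryCoord [FiniteDimensional ℝ V] (he : IsUnitaryFrame J e)
    (hJ : IsOrthogonalComplexStructure J) (hV : Module.finrank ℝ V = 2 * n) :
    ∃ c : V ≃ₗ[ℝ] (Fin n → ℂ), IsUnitaryCoord J c ∧ ∀ k, c.symm (Pi.single k 1) = e k := by
  have hinner := he.inner_eq_sum_coord hJ hV
  have hinj : Function.Injective (coord J e) :=
    LinearMap.ker_eq_bot.1 <| LinearMap.ker_eq_bot'.2 fun u hu ↦ by simpa [hu] using hinner u u
  let c := LinearEquiv.ofInjectiveOfFinrankEq (coord J e) hinj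
    (by simp [hV, Module.finrank_pi_fintype, Complex.finrank_real_complex, mul_comm])
  refine ⟨c, ⟨fun u k ↦ ?_, hinner⟩, fun k ↦ c.symm_apply_eq.2 (funext fun l ↦ ?_)⟩
  · change coord J e (J u) k = Complex.I * coord J e u k
    simp [Complex.ext_iff, coord_apply, hJ.inner_J_left, hJ.J_J]
  · change _ = coord J e (e k) l
    by_cases h : l = k <;>
      simp [-inner_self_eq_norm_sq_to_K, Complex.ext_iff, coord_apply, he.inner_eq,
        hJ.inner_J_left, he.inner_J_eq, h]

end IsUnitaryFrame

/-- The real multilinear map `Ψ` on `V` is complex multilinear for the complex structure `J`. -/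
def IsComplexMultilinear (J : V →ₗ[ℝ] V) (Ψ : V [⋀^Fin n]→ₗ[ℝ] ℂ) : Prop :=
  ∀ v i, Ψ (Function.update v i (J (v i))) = Complex.I * Ψ v

theorem IsComplexMultilinear.of_slot {J : V →ₗ[ℝ] V} {Ψ : V [⋀^Fin n]→ₗ[ℝ] ℂ} (i : Fin n)
    (h : ∀ v, Ψ (Function.update v i (J (v i))) = Complex.I * Ψ v) :
    IsComplexMultilinear J Ψ := by
  intro v j
  rcases eq_or_ne i j with rfl | hij
  · exact h v
  have hv := h (v ∘ Equiv.swap i j)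
  have hupdate : Function.update (v ∘ Equiv.swap i j) i (J (v j)) =
      Function.update v j (J (v j)) ∘ Equiv.swap i j := by
    rw [Function.update_comp_equiv, Equiv.symm_swap, Equiv.swap_apply_right]
  rw [Function.comp_apply, Equiv.swap_apply_left, hupdate, Ψ.map_swap _ hij, Ψ.map_swap _ hij,
    mul_neg, neg_inj] at hv
  exact hv

/-- Unitary coordinates in which `Ψ` is the determinant. -/
structure IsSpecialUnitaryCoord (J : V →ₗ[ℝ] V) (Ψ : V [⋀^Fin n]→ₗ[ℝ] ℂ)
    (c : V ≃ₗ[ℝ] (Fin n → ℂ)) : Prop extends IsUnitaryCoord J c where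
  Ψ_eq : ∀ v, Ψ v = (Pi.basisFun ℂ (Fin n)).det fun i ↦ c (v i)

namespace IsUnitaryCoord

variable {J : V →ₗ[ℝ] V} {c : V ≃ₗ[ℝ] (Fin n → ℂ)}

theorem symm_smul (hc : IsUnitaryCoord J c) (z : ℂ) (x : Fin n → ℂ) :
    c.symm (z • x) = z.re • c.symm x + z.im • J (c.symm x) := by
  rw [LinearEquiv.symm_apply_eq]
  ext k
  simp only [map_add, map_smul, Pi.add_apply, Pi.smul_apply, hc.map_J, c.apply_symm_apply,
    Complex.real_smul, smul_eq_mul]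
  linear_combination -(x k) * Complex.re_add_im z

/-- A complex multilinear form, transported to `ℂⁿ` by unitary coordinates. -/
def transport (hc : IsUnitaryCoord J c) {Ψ : V [⋀^Fin n]→ₗ[ℝ] ℂ} (hΨ : IsComplexMultilinear J Ψ) :
    (Fin n → ℂ) [⋀^Fin n]→ₗ[ℂ] ℂ where
  toFun v := Ψ fun i ↦ c.symm (v i)
  map_update_add' v i x y := by
    have h (w) : (fun j ↦ c.symm (Function.update v i w j)) =
        Function.update (fun j ↦ c.symm (v j)) i (c.symm w) :=
      funext fun j ↦ Function.apply_update (fun _ ↦ c.symm) v i w j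
    simp only [h, map_add, AlternatingMap.map_update_add]
  map_update_smul' {inst} v i z x := by
    obtain rfl : inst = instDecidableEqFin n := Subsingleton.elim _ _
    have h (w) : (fun j ↦ c.symm (Function.update v i w j)) =
        Function.update (fun j ↦ c.symm (v j)) i (c.symm w) :=
      funext fun j ↦ Function.apply_update (fun _ ↦ c.symm) v i w j
    have hJ := hΨ (Function.update (fun j ↦ c.symm (v j)) i (c.symm x)) i
    rw [Function.update_idem, Function.update_self] at hJ
    simp only [h, hc.symm_smul, AlternatingMap.map_update_add, AlternatingMap.map_update_smul, hJ]
    simp only [Complex.real_smul, smul_eq_mul]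
    linear_combination Ψ (Function.update (fun j ↦ c.symm (v j)) i (c.symm x)) * z.re_add_im
  map_eq_zero_of_eq' v i j h hij := Ψ.map_eq_zero_of_eq _ (by rw [h]) hij

theorem eq_mul_det (hc : IsUnitaryCoord J c) {Ψ : V [⋀^Fin n]→ₗ[ℝ] ℂ}
    (hΨ : IsComplexMultilinear J Ψ) (v : Fin n → V) :
    Ψ v = Ψ (fun k ↦ c.symm (Pi.single k 1)) * (Pi.basisFun ℂ (Fin n)).det fun i ↦ c (v i) := by
  have h := DFunLike.congr_fun ((hc.transport hΨ).eq_smul_basis_det (Pi.basisFun ℂ (Fin n)))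
    fun i ↦ c (v i)
  simpa only [transport, AlternatingMap.smul_apply, AlternatingMap.coe_mk, MultilinearMap.coe_mk,
    c.symm_apply_apply, Pi.basisFun_apply, smul_eq_mul] using h

/- The first coordinate of `c` is multiplied by the unit complex number `Ψ(e₁, …, eₙ)`. -/
theorem exists_isSpecialUnitaryCoord [NeZero n] (hc : IsUnitaryCoord J c) {Ψ : V [⋀^Fin n]→ₗ[ℝ] ℂ}
    (hΨ : IsComplexMultilinear J Ψ)
    (hnorm : Complex.normSq (Ψ fun k ↦ c.symm (Pi.single k 1)) = 1) :
    ∃ c' : V ≃ₗ[ℝ] (Fin n → ℂ), IsSpecialUnitaryCoord J Ψ c' := by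
  have hdet := hc.eq_mul_det hΨ
  set z := Ψ fun k ↦ c.symm (Pi.single k 1)
  have hz : z ≠ 0 := by rintro h; simp [h] at hnorm
  let a : Fin n → ℂ := fun k ↦ if k = 0 then z else 1
  have ha (k) : a k ≠ 0 := by by_cases h : k = 0 <;> simp [a, h, hz]
  have ha' (k) : (a k).re * (a k).re + (a k).im * (a k).im = 1 := by
    rw [← Complex.normSq_apply]
    by_cases h : k = 0 <;> simp [a, h, hnorm]
  refine ⟨c.trans <| LinearEquiv.piCongrRight fun k ↦
    (LinearEquiv.smulOfNeZero ℂ ℂ (a k) (ha k)).restrictScalars ℝ,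
    ⟨⟨fun u k ↦ ?_, fun u v ↦ ?_⟩, fun v ↦ ?_⟩⟩
  · simp [hc.map_J, mul_left_comm]
  · rw [hc.inner_eq]
    refine Finset.sum_congr rfl fun k _ ↦ ?_
    simp only [LinearEquiv.trans_apply, LinearEquiv.piCongrRight_apply,
      LinearEquiv.restrictScalars_apply, LinearEquiv.smulOfNeZero_apply, smul_eq_mul,
      Complex.mul_re, Complex.mul_im]
    linear_combination (-(c u k).re * (c v k).re - (c u k).im * (c v k).im) * ha' k
  · rw [hdet, Pi.basisFun_det_apply, Pi.basisFun_det_apply]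
    have h := Matrix.det_mul_row a (Matrix.of fun i ↦ c (v i))
    simp only [a, Finset.prod_ite_eq', Finset.mem_univ, if_true] at h
    exact h.symm

end IsUnitaryCoord

end HermitianAlgebra

noncomputable section AlgebraicCurvature

local notation "⟪" u ", " v "⟫" => inner ℝ u v

variable {V : Type*} [NormedAddCommGroup V] [InnerProductSpace ℝ V]

section UnitaryCoord

variable {n : ℕ} {J : V →ₗ[ℝ] V} {Ψ : V [⋀^Fin n]→ₗ[ℝ] ℂ} {c : V ≃ₗ[ℝ] (Fin n → ℂ)}

namespace IsUnitaryCoord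

theorem isUnitaryFrame (hc : IsUnitaryCoord J c) :
    IsUnitaryFrame J fun k ↦ c.symm (Pi.single k 1) where
  inner_eq i j := by
    simp [hc.inner_eq, Pi.single_apply, apply_ite Complex.re, apply_ite Complex.im, eq_comm]
  inner_J_eq i j := by
    simp [hc.inner_eq, hc.map_J, Pi.single_apply, apply_ite Complex.re, apply_ite Complex.im]

theorem exists_orthonormalBasis (hc : IsUnitaryCoord J c) (hJ : IsOrthogonalComplexStructure J) :
    ∃ b : OrthonormalBasis (Fin n ⊕ Fin n) ℝ V,
      (∀ k, b (.inl k) = c.symm (Pi.single k 1)) ∧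
        ∀ k, b (.inr k) = J (c.symm (Pi.single k 1)) := by
  have : FiniteDimensional ℝ V := Module.Finite.equiv c.symm
  obtain ⟨b, hb⟩ := hc.isUnitaryFrame.exists_orthonormalBasis hJ
    (by simp [c.finrank_eq, Module.finrank_pi_fintype, Complex.finrank_real_complex, mul_comm])
  exact ⟨b, by simp [hb], by simp [hb]⟩

theorem coord_eq_inner (hc : IsUnitaryCoord J c) (u : V) (k : Fin n) :
    c u k = ⟨⟪u, c.symm (Pi.single k 1)⟫, ⟪u, J (c.symm (Pi.single k 1))⟫⟩ := by
  simp [hc.inner_eq, hc.map_J, Pi.single_apply, apply_ite Complex.re, apply_ite Complex.im]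

theorem eq_sum (hc : IsUnitaryCoord J c) (u : V) :
    u = ∑ k, ((c u k).re • c.symm (Pi.single k 1) + (c u k).im • J (c.symm (Pi.single k 1))) := by
  simp_rw [← hc.symm_smul, ← map_sum]
  rw [LinearEquiv.eq_symm_apply]
  simpa using (pi_eq_sum_univ' (c u))

theorem eq_sum_mul (hc : IsUnitaryCoord J c) {γ : V →ₗ[ℝ] ℂ}
    (hγ : ∀ u, γ (J u) = Complex.I * γ u) (u : V) :
    γ u = ∑ k, c u k * γ (c.symm (Pi.single k 1)) := by
  conv_lhs => rw [hc.eq_sum u]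
  simp only [map_sum, map_add, map_smul, hγ, Complex.real_smul]
  refine Finset.sum_congr rfl fun k _ ↦ ?_
  linear_combination γ (c.symm (Pi.single k 1)) * Complex.re_add_im (c u k)

end IsUnitaryCoord

namespace IsSpecialUnitaryCoord

theorem Ψ_update_eq (hc : IsSpecialUnitaryCoord J Ψ c) (v : Fin n → V) (k : Fin n) (u : V) :
    Ψ (Function.update v k u) =
      (Pi.basisFun ℂ (Fin n)).det (Function.update (fun i ↦ c (v i)) k (c u)) := by
  rw [hc.Ψ_eq]
  exact congrArg _ (funext fun j ↦ Function.apply_update (fun _ ↦ c) v k u j)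

theorem Ψ_frame (hc : IsSpecialUnitaryCoord J Ψ c) :
    Ψ (fun k ↦ c.symm (Pi.single k 1)) = 1 := by
  simpa only [hc.Ψ_eq, LinearEquiv.apply_symm_apply, ← Pi.basisFun_apply ℂ]
    using (Pi.basisFun ℂ (Fin n)).det_self

theorem Ψ_update_frame (hc : IsSpecialUnitaryCoord J Ψ c) (u : V) (k : Fin n) :
    Ψ (Function.update (fun k ↦ c.symm (Pi.single k 1)) k u) = c u k := by
  set b := Pi.basisFun ℂ (Fin n)
  have hcu : c u = ∑ l, c u l • b l := by simpa [b] using pi_eq_sum_univ' (c u)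
  have hb (k) : c (c.symm (Pi.single k 1)) = b k := by simp [b]
  simp only [hc.Ψ_update_eq, hb]
  rw [hcu, AlternatingMap.map_update_sum, Finset.sum_eq_single k]
  · rw [AlternatingMap.map_update_smul, Function.update_eq_self, b.det_self, ← hcu, smul_eq_mul,
      mul_one]
  · intro l _ hl
    rw [AlternatingMap.map_update_smul, AlternatingMap.map_update_self _ _ hl.symm, smul_zero]
  · simp

theorem isComplexMultilinear (hc : IsSpecialUnitaryCoord J Ψ c) : IsComplexMultilinear J Ψ := by
  intro v i
  have hJ : c (J (v i)) = Complex.I • c (v i) := funext (hc.map_J _)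
  rw [hc.Ψ_update_eq, hJ, AlternatingMap.map_update_smul, Function.update_eq_self, hc.Ψ_eq,
    smul_eq_mul]

end IsSpecialUnitaryCoord

end UnitaryCoord

/-- The symmetries of a Riemannian curvature tensor. -/
structure IsAlgebraicCurvature (K : V → V → V → V → ℝ) : Prop where
  swap₁₂ : ∀ u v y z, K u v y z = -K v u y z
  swap₃₄ : ∀ u v y z, K u v y z = -K u v z y
  bianchi : ∀ u v y z, K u v y z + K v y u z + K y u v z = 0
  add₄ : ∀ u v y z z', K u v y (z + z') = K u v y z + K u v y z'
  smul₄ : ∀ u v y (r : ℝ) z, K u v y (r • z) = r * K u v y z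

namespace IsAlgebraicCurvature

variable {K : V → V → V → V → ℝ}

theorem pair (hK : IsAlgebraicCurvature K) (u v y z : V) : K u v y z = K y z u v := by
  linarith [hK.bianchi u v y z, hK.bianchi v y z u, hK.bianchi y z u v, hK.bianchi z u v y,
    hK.swap₃₄ v y z u, hK.swap₃₄ y z v u, hK.swap₁₂ z v y u, hK.swap₁₂ z u y v, hK.swap₃₄ u z y v,
    hK.swap₁₂ u y z v, hK.swap₃₄ y u z v, hK.swap₁₂ z u v y, hK.swap₃₄ u v z y, hK.swap₃₄ v z u y]

theorem bianchi_last (hK : IsAlgebraicCurvature K) (u v y z : V) :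
    K u v y z + K u y z v + K u z v y = 0 := by
  rw [hK.pair u v, hK.pair u y, hK.pair u z, hK.swap₃₄ y z, hK.swap₃₄ z v, hK.swap₃₄ v y]
  linarith [hK.bianchi y z v u]

theorem neg₄ (hK : IsAlgebraicCurvature K) (u v y z : V) : K u v y (-z) = -K u v y z := by
  rw [← neg_one_smul ℝ z, hK.smul₄, neg_one_mul]

theorem add₃ (hK : IsAlgebraicCurvature K) (u v y y' z : V) :
    K u v (y + y') z = K u v y z + K u v y' z := by
  rw [hK.swap₃₄, hK.add₄, hK.swap₃₄ u v y, hK.swap₃₄ u v y']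
  ring

theorem smul₃ (hK : IsAlgebraicCurvature K) (u v : V) (r : ℝ) (y z : V) :
    K u v (r • y) z = r * K u v y z := by
  rw [hK.swap₃₄, hK.smul₄, hK.swap₃₄ u v y]
  ring

theorem add₂ (hK : IsAlgebraicCurvature K) (u v v' y z : V) :
    K u (v + v') y z = K u v y z + K u v' y z := by
  rw [hK.pair, hK.add₄, hK.pair u v, hK.pair u v']

theorem smul₂ (hK : IsAlgebraicCurvature K) (u : V) (r : ℝ) (v y z : V) :
    K u (r • v) y z = r * K u v y z := by
  rw [hK.pair, hK.smul₄, hK.pair u v]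

end IsAlgebraicCurvature

/-- The curvature tensor of the unit sphere, `R_{u,v} y = ⟪u, y⟫ v - ⟪v, y⟫ u`. -/
def sphereCurvature (u v y z : V) : ℝ := ⟪u, y⟫ * ⟪v, z⟫ - ⟪u, z⟫ * ⟪v, y⟫

theorem IsAlgebraicCurvature.sub_sphereCurvature {K : V → V → V → V → ℝ}
    (hK : IsAlgebraicCurvature K) (α : ℝ) :
    IsAlgebraicCurvature fun u v y z ↦ K u v y z - α * sphereCurvature u v y z where
  swap₁₂ u v y z := by rw [hK.swap₁₂, sphereCurvature, sphereCurvature]; ring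
  swap₃₄ u v y z := by rw [hK.swap₃₄, sphereCurvature, sphereCurvature]; ring
  bianchi u v y z := by
    simp only [sphereCurvature]
    rw [real_inner_comm v u, real_inner_comm y u, real_inner_comm y v]
    linear_combination hK.bianchi u v y z
  add₄ u v y z z' := by simp only [sphereCurvature, hK.add₄, inner_add_right]; ring
  smul₄ u v y r z := by simp only [sphereCurvature, hK.smul₄, inner_smul_right]; ring

section Threefold

variable {J : V →ₗ[ℝ] V} {Ψ : V [⋀^Fin 3]→ₗ[ℝ] ℂ} {c : V ≃ₗ[ℝ] (Fin 3 → ℂ)}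

namespace IsComplexMultilinear

theorem map_J₀ (hΨ : IsComplexMultilinear J Ψ) (u v w : V) :
    Ψ ![J u, v, w] = Complex.I * Ψ ![u, v, w] := by
  convert hΨ ![u, v, w] 0 using 2
  ext k
  fin_cases k <;> rfl

theorem map_J₂ (hΨ : IsComplexMultilinear J Ψ) (u v w : V) :
    Ψ ![u, v, J w] = Complex.I * Ψ ![u, v, w] := by
  convert hΨ ![u, v, w] 2 using 2
  ext k
  fin_cases k <;> rfl

end IsComplexMultilinear

namespace IsSpecialUnitaryCoord

theorem Ψ_apply (hc : IsSpecialUnitaryCoord J Ψ c) (u v w : V) : Ψ ![u, v, w] =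
    c u 0 * (c v 1 * c w 2 - c v 2 * c w 1) - c u 1 * (c v 0 * c w 2 - c v 2 * c w 0)
      + c u 2 * (c v 0 * c w 1 - c v 1 * c w 0) := by
  rw [hc.Ψ_eq, Pi.basisFun_det_apply, Matrix.det_fin_three]
  simp only [Matrix.of_apply, Matrix.cons_val]
  ring

theorem Ψ_frame_three (hc : IsSpecialUnitaryCoord J Ψ c) :
    Ψ ![c.symm (Pi.single 0 1), c.symm (Pi.single 1 1), c.symm (Pi.single 2 1)] = 1 := by
  simp [hc.Ψ_apply]

theorem eq_of_re_mul_Ψ_eq (hc : IsSpecialUnitaryCoord J Ψ c) {z z' : ℂ}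
    (h : ∀ u v w, (z * Ψ ![u, v, w]).re = (z' * Ψ ![u, v, w]).re) : z = z' := by
  set e : Fin 3 → V := fun k ↦ c.symm (Pi.single k 1)
  have he : Ψ ![e 0, e 1, e 2] = 1 := hc.Ψ_frame_three
  have h₁ := h (e 0) (e 1) (e 2)
  have h₂ := h (J (e 0)) (e 1) (e 2)
  rw [hc.isComplexMultilinear.map_J₀] at h₂
  rw [he, mul_one, mul_one] at h₁
  rw [he, mul_one, Complex.mul_I_re, Complex.mul_I_re, neg_inj] at h₂
  exact Complex.ext h₁ h₂

/-- The `(4, 0)`-form `γ ∧ Ψ` vanishes. -/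
theorem map_mul_Ψ (hc : IsSpecialUnitaryCoord J Ψ c) {γ : V →ₗ[ℝ] ℂ}
    (hγ : ∀ u, γ (J u) = Complex.I * γ u) (u v y z : V) :
    γ u * Ψ ![v, y, z] = γ v * Ψ ![u, y, z] + γ y * Ψ ![u, z, v] + γ z * Ψ ![u, v, y] := by
  have hsum := hc.eq_sum_mul hγ
  rw [hsum u, hsum v, hsum y, hsum z]
  simp only [hc.Ψ_apply, Fin.sum_univ_three]
  ring

/-- The first Bianchi identity for `K(u, ·, ·, ·)`, combined with the same identity in which `v`,
`y`, `z` are rotated by `J`. -/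
theorem re_mul_Ψ_of_curvature (hc : IsSpecialUnitaryCoord J Ψ c)
    (hJ : IsOrthogonalComplexStructure J) {K : V → V → V → V → ℝ} (hK : IsAlgebraicCurvature K)
    {β : V → ℂ} (h : ∀ u v y z,
      K u v y (J z) + K u v (J y) z = (β u * Ψ ![v, y, z] - β v * Ψ ![u, y, z]).re) (u v y z : V) :
    (6 * β u * Ψ ![v, y, z]).re =
      ((β v - Complex.I * β (J v)) * Ψ ![u, y, z] + (β y - Complex.I * β (J y)) * Ψ ![u, z, v]
        + (β z - Complex.I * β (J z)) * Ψ ![u, v, y]).re := by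
  have hΨ := hc.isComplexMultilinear
  have cyc (v y z) : Ψ ![y, z, v] = Ψ ![v, y, z] := by simp only [hc.Ψ_apply]; ring
  have hJJ (v y z) : K u (J v) y z - K u (J v) (J y) (J z) =
      (β u * Ψ ![v, y, z] + Complex.I * β (J v) * Ψ ![u, y, z]).re := by
    have h' := h u (J v) y (J z)
    rw [hJ.J_J, hK.neg₄, hΨ.map_J₀, hΨ.map_J₂, hΨ.map_J₂] at h'
    simp only [Complex.add_re, Complex.sub_re, Complex.mul_re, Complex.mul_im, Complex.I_re,
      Complex.I_im] at h' ⊢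
    linarith
  have h₁ := h u v y z
  have h₂ := h u y z v
  have h₃ := h u z v y
  have h₁' := hJJ v y z
  have h₂' := hJJ y z v
  have h₃' := hJJ z v y
  rw [cyc v y z] at h₂ h₂'
  rw [cyc y z v, cyc v y z] at h₃ h₃'
  have h6 : (6 * β u * Ψ ![v, y, z]).re = 6 * (β u * Ψ ![v, y, z]).re := by
    simp [mul_assoc]
  simp only [Complex.add_re, Complex.sub_re, sub_mul] at h₁ h₂ h₃ h₁' h₂' h₃' ⊢
  linarith [hK.bianchi_last u v y (J z), hK.bianchi_last u v (J y) z, hK.bianchi_last u (J v) y z,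
    hK.bianchi_last u (J v) (J y) (J z)]

theorem eq_zero_of_curvature (hc : IsSpecialUnitaryCoord J Ψ c)
    (hJ : IsOrthogonalComplexStructure J) {K : V → V → V → V → ℝ} (hK : IsAlgebraicCurvature K)
    {β : V →ₗ[ℝ] ℂ} (h : ∀ u v y z,
      K u v y (J z) + K u v (J y) z = (β u * Ψ ![v, y, z] - β v * Ψ ![u, y, z]).re) : β = 0 := by
  let γ : V →ₗ[ℝ] ℂ := β - (LinearMap.mulLeft ℝ Complex.I) ∘ₗ β ∘ₗ J
  have hγ (u) : γ u = β u - Complex.I * β (J u) := rfl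
  have hγJ (u) : γ (J u) = Complex.I * γ u := by
    rw [hγ, hγ, hJ.J_J, map_neg]
    linear_combination β (J u) * Complex.I_mul_I
  have h6 (u) : 6 * β u = γ u := hc.eq_of_re_mul_Ψ_eq fun v y z ↦ by
    rw [hc.re_mul_Ψ_of_curvature hJ hK h, hc.map_mul_Ψ hγJ, hγ, hγ, hγ]
  ext u
  have h24 : 24 * β u = 0 := by
    have h₁ := h6 u
    have h₂ := h6 (J u)
    rw [hγJ] at h₂
    rw [hγ] at h₁ h₂
    linear_combination 5 * h₁ - Complex.I * h₂
      + (Complex.I * β (J u) - β u) * Complex.I_mul_I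
  simpa using h24

end IsSpecialUnitaryCoord

end Threefold

section RicciFlat

variable {J : V →ₗ[ℝ] V} {ι : Type*} [Fintype ι]

theorem sum_orthonormalBasis_eq {ι' : Type*} [Fintype ι'] (B : V →ₗ[ℝ] V →ₗ[ℝ] ℝ)
    (b : OrthonormalBasis ι ℝ V) (b' : OrthonormalBasis ι' ℝ V) :
    ∑ i, B (b i) (b i) = ∑ j, B (b' j) (b' j) := by
  have hb (i : ι) : B (b i) (b i) = ∑ j, ⟪b' j, b i⟫ * B (b' j) (b i) := by
    have := congrArg (fun t ↦ B t (b i)) (b'.sum_repr' (b i)).symm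
    simpa only [map_sum, LinearMap.sum_apply, map_smul, LinearMap.smul_apply, smul_eq_mul]
      using this
  have hb' (j : ι') : B (b' j) (b' j) = ∑ i, ⟪b i, b' j⟫ * B (b' j) (b i) := by
    have := congrArg (fun t ↦ B (b' j) t) (b.sum_repr' (b' j)).symm
    simpa only [map_sum, map_smul, smul_eq_mul] using this
  simp only [hb, hb']
  rw [Finset.sum_comm]
  simp only [real_inner_comm]

namespace IsOrthogonalComplexStructure

theorem exists_orthonormalBasis (hJ : IsOrthogonalComplexStructure J)
    (b : OrthonormalBasis ι ℝ V) : ∃ b' : OrthonormalBasis ι ℝ V, ∀ i, b' i = J (b i) := by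
  let e : V ≃ₗᵢ[ℝ] V :=
    { toLinearEquiv :=
        LinearEquiv.ofLinearMap J (-J) (by ext; simp [hJ.J_J]) (by ext; simp [hJ.J_J])
      norm_map' u := by
        change ‖J u‖ = ‖u‖
        rw [norm_eq_sqrt_real_inner, hJ.inner_J_J, ← norm_eq_sqrt_real_inner] }
  exact ⟨b.map e, fun i ↦ by simp [e]⟩

end IsOrthogonalComplexStructure

namespace IsAlgebraicCurvature

variable {K : V → V → V → V → ℝ}

theorem map_J_J (hK : IsAlgebraicCurvature K) (hJ : IsOrthogonalComplexStructure J)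
    (h : ∀ u v y z, K u v y (J z) + K u v (J y) z = 0) (u v y z : V) :
    K u v (J y) (J z) = K u v y z := by
  have := h u v y (J z)
  rw [hJ.J_J, hK.neg₄] at this
  linarith

/-- For a curvature tensor of Kähler type the Ricci tensor is half of the complex trace, by the
first Bianchi identity. -/
theorem ricci_eq_zero (hK : IsAlgebraicCurvature K) (hJ : IsOrthogonalComplexStructure J)
    (h : ∀ u v y z, K u v y (J z) + K u v (J y) z = 0) (b : OrthonormalBasis ι ℝ V)
    (htr : ∀ u v, ∑ i, K u v (b i) (J (b i)) = 0) (u v : V) : ∑ i, K u (b i) v (b i) = 0 := by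
  obtain ⟨b', hb'⟩ := hJ.exists_orthonormalBasis b
  have hJJ := hK.map_J_J hJ h
  have hinv : ∑ i, K (J v) (b i) (J u) (b i) = ∑ i, K u (b i) v (b i) := by
    let B : V →ₗ[ℝ] V →ₗ[ℝ] ℝ := LinearMap.mk₂ ℝ (fun a d ↦ K (J v) a (J u) d)
      (fun _ _ _ ↦ hK.add₂ _ _ _ _ _) (fun _ _ _ ↦ hK.smul₂ _ _ _ _ _)
      (fun _ _ _ ↦ hK.add₄ _ _ _ _ _) (fun _ _ _ ↦ hK.smul₄ _ _ _ _ _)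
    refine (sum_orthonormalBasis_eq B b b').trans (Finset.sum_congr rfl fun i _ ↦ ?_)
    simp only [B, LinearMap.mk₂_apply, hb']
    rw [hJJ, hK.pair, hJJ]
  have hterm (i : ι) : K u (J v) (b i) (J (b i)) =
      K (J v) (b i) (J u) (b i) + K u (b i) v (b i) := by
    linarith [hK.bianchi u (J v) (b i) (J (b i)), h (J v) (b i) u (b i), hJJ (b i) u v (b i),
      hK.swap₁₂ (b i) u v (b i)]
  have hsum := htr u (J v)
  simp only [hterm, Finset.sum_add_distrib, hinv] at hsum
  linarith

end IsAlgebraicCurvature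

section ComplexTrace

variable {n : ℕ} {Ψ : V [⋀^Fin n]→ₗ[ℝ] ℂ} {c : V ≃ₗ[ℝ] (Fin n → ℂ)} {A : V →ₗ[ℝ] V}

theorem IsComplexMultilinear.sum_update (hΨ : IsComplexMultilinear J Ψ)
    (hAJ : ∀ y, A (J y) = J (A y)) (v : Fin n → V) (i : Fin n) :
    ∑ k, Ψ (Function.update (Function.update v i (J (v i))) k
        (A (Function.update v i (J (v i)) k))) =
      Complex.I * ∑ k, Ψ (Function.update v k (A (v k))) := by
  rw [Finset.mul_sum]
  refine Finset.sum_congr rfl fun k _ ↦ ?_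
  rw [← hΨ _ i]
  rcases eq_or_ne k i with rfl | hki
  · simp only [Function.update_self, Function.update_idem, hAJ]
  · rw [Function.update_of_ne hki, Function.update_of_ne hki.symm, Function.update_comm hki]

theorem IsSpecialUnitaryCoord.sum_Ψ_update_frame (hc : IsSpecialUnitaryCoord J Ψ c)
    (hskew : ∀ y z, ⟪A y, z⟫ = -⟪A z, y⟫) :
    ∑ k, Ψ (Function.update (fun k ↦ c.symm (Pi.single k 1)) k (A (c.symm (Pi.single k 1)))) =
      Complex.I * (∑ k, ⟪A (c.symm (Pi.single k 1)), J (c.symm (Pi.single k 1))⟫ : ℝ) := by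
  have hself (y : V) : ⟪A y, y⟫ = 0 := by linarith [hskew y y]
  rw [Complex.ofReal_sum, Finset.mul_sum]
  refine Finset.sum_congr rfl fun k _ ↦ ?_
  rw [hc.Ψ_update_frame, hc.coord_eq_inner, hself]
  apply Complex.ext <;> simp

theorem IsSpecialUnitaryCoord.sum_inner_J_eq_zero [NeZero n] (hc : IsSpecialUnitaryCoord J Ψ c)
    (hJ : IsOrthogonalComplexStructure J) {w : ℂ} (hw : w ≠ 0)
    (hskew : ∀ y z, ⟪A y, z⟫ = -⟪A z, y⟫) (hAJ : ∀ y, A (J y) = J (A y))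
    (hA : ∀ v, (w * ∑ k, Ψ (Function.update v k (A (v k)))).re = 0)
    (b : OrthonormalBasis ι ℝ V) : ∑ i, ⟪A (b i), J (b i)⟫ = 0 := by
  obtain ⟨b', hb₁, hb₂⟩ := hc.exists_orthonormalBasis hJ
  let B : V →ₗ[ℝ] V →ₗ[ℝ] ℝ := (innerₗ V).compl₁₂ A J
  refine (sum_orthonormalBasis_eq B b b').trans ?_
  set e : Fin n → V := fun k ↦ c.symm (Pi.single k 1)
  set τ : ℝ := ∑ k, ⟪A (e k), J (e k)⟫
  have hτ : τ = 0 := by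
    by_contra hτ
    have h₁ := hA e
    have h₂ := hA (Function.update e 0 (J (e 0)))
    rw [hc.isComplexMultilinear.sum_update hAJ] at h₂
    rw [hc.sum_Ψ_update_frame hskew] at h₁ h₂
    refine hw (Complex.ext ?_ ?_)
    · simpa [hτ, τ, e] using h₂
    · simpa [hτ, τ, e] using h₁
  change ∑ i, ⟪A (b' i), J (b' i)⟫ = 0
  simp only [Fintype.sum_sum_type, hb₁, hb₂, hAJ, hJ.inner_J_J]
  linarith

end ComplexTrace

end RicciFlat

end AlgebraicCurvature

noncomputable section TorsionAlgebra

open scoped ComplexConjugate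

local notation "⟪" u ", " v "⟫" => inner ℝ u v

variable {V : Type*} [NormedAddCommGroup V] [InnerProductSpace ℝ V]

section Skew

variable [FiniteDimensional ℝ V]

theorem eq_zero_of_trace_mul_self_eq_zero {B : Module.End ℝ V}
    (hB : ∀ u v, ⟪B u, v⟫ = -⟪u, B v⟫) (htr : LinearMap.trace ℝ V (B * B) = 0) : B = 0 := by
  have hBB (u : V) : ⟪u, (B * B) u⟫ = -‖B u‖ ^ 2 := by
    rw [← real_inner_self_eq_norm_sq, hB, neg_neg, Module.End.mul_apply]
  rw [LinearMap.trace_eq_sum_inner _ (stdOrthonormalBasis ℝ V)] at htr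
  simp only [hBB, Finset.sum_neg_distrib, neg_eq_zero] at htr
  rw [Finset.sum_eq_zero_iff_of_nonneg (fun _ _ ↦ by positivity)] at htr
  refine (stdOrthonormalBasis ℝ V).toBasis.ext fun i ↦ ?_
  simpa using htr i (Finset.mem_univ i)

/-- The unitary part `A - J A J` of `A` is orthogonal to itself. -/
theorem IsOrthogonalComplexStructure.map_J_eq_neg {J A : Module.End ℝ V}
    (hJ : IsOrthogonalComplexStructure J) (hA : ∀ u v, ⟪A u, v⟫ = -⟪u, A v⟫)
    (hperp : ∀ B : Module.End ℝ V, (∀ u v, ⟪B u, v⟫ = -⟪u, B v⟫) → (∀ u, B (J u) = J (B u)) →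
      LinearMap.trace ℝ V (A * B) = 0) (u : V) : A (J u) = -J (A u) := by
  have hJJ : J * J = -1 := LinearMap.ext hJ.J_J
  set B : Module.End ℝ V := A - J * A * J
  have hBu (u : V) : B u = A u - J (A (J u)) := rfl
  have hBskew (u v : V) : ⟪B u, v⟫ = -⟪u, B v⟫ := by
    rw [hBu, hBu, inner_sub_left, inner_sub_right, hJ.inner_J_left, hA, hA, hJ.inner_J_left]
    ring
  have hBJ (u : V) : B (J u) = J (B u) := by
    simp only [hBu, map_sub, hJ.J_J, map_neg]
    abel
  have hBB : B * B = A * B - J * (A * B * J) := by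
    have hcomm : B * J = J * B := LinearMap.ext hBJ
    rw [mul_assoc A B J, hcomm, ← mul_assoc A, ← mul_assoc J, ← mul_assoc J, ← sub_mul]
  have htr : LinearMap.trace ℝ V (B * B) = 0 := by
    rw [hBB, map_sub, LinearMap.trace_mul_comm ℝ J, mul_assoc _ J J, hJJ, mul_neg, mul_one,
      map_neg, hperp B hBskew hBJ, neg_zero, sub_zero]
  have hJu := hBu (J u)
  rw [eq_zero_of_trace_mul_self_eq_zero hBskew htr, hJ.J_J, map_neg, map_neg, sub_neg_eq_add]
    at hJu
  exact eq_neg_of_add_eq_zero_left hJu.symm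

end Skew

/-- A trilinear form that changes sign under the transpositions `(0 1)` and `(1 2)`, as an
alternating map. -/
def alternatingOfSwap (f : V → V → V → ℂ) (add : ∀ u u' v w, f (u + u') v w = f u v w + f u' v w)
    (smul : ∀ (r : ℝ) u v w, f (r • u) v w = r • f u v w) (swap₀₁ : ∀ u v w, f u v w = -f v u w)
    (swap₁₂ : ∀ u v w, f u v w = -f u w v) : V [⋀^Fin 3]→ₗ[ℝ] ℂ where
  toFun v := f (v 0) (v 1) (v 2)
  map_update_add' {inst} v i x y := by
    obtain rfl : inst = instDecidableEqFin 3 := Subsingleton.elim _ _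
    have add₁ (u v v' w) : f u (v + v') w = f u v w + f u v' w := by
      rw [swap₀₁, add, neg_add, ← swap₀₁, ← swap₀₁]
    have add₂ (u v w w') : f u v (w + w') = f u v w + f u v w' := by
      rw [swap₁₂, add₁, neg_add, ← swap₁₂, ← swap₁₂]
    fin_cases i <;> simp [add, add₁, add₂]
  map_update_smul' {inst} v i r x := by
    obtain rfl : inst = instDecidableEqFin 3 := Subsingleton.elim _ _
    have smul₁ (r : ℝ) (u v w) : f u (r • v) w = r • f u v w := by
      rw [swap₀₁, smul, ← smul_neg, ← swap₀₁]
    have smul₂ (r : ℝ) (u v w) : f u v (r • w) = r • f u v w := by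
      rw [swap₁₂, smul₁, ← smul_neg, ← swap₁₂]
    fin_cases i <;> simp [smul, smul₁, smul₂]
  map_eq_zero_of_eq' v i j h hij := by
    have h₀₁ (u w) : f u u w = 0 := self_eq_neg.1 (swap₀₁ u u w)
    have h₁₂ (u w) : f u w w = 0 := self_eq_neg.1 (swap₁₂ u w w)
    have h₀₂ (u w) : f u w u = 0 := by rw [swap₁₂, h₀₁, neg_zero]
    fin_cases i <;> fin_cases j <;> simp at h hij <;> simp [h, h₀₁, h₁₂, h₀₂]

theorem sum_update_three {X N : Type*} [AddCommMonoid N] (f : (Fin 3 → X) → N) (A : X → X)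
    (a b c : X) : ∑ k, f (Function.update ![a, b, c] k (A (![a, b, c] k))) =
      f ![A a, b, c] + f ![a, A b, c] + f ![a, b, A c] := by
  rw [Fin.sum_univ_three]
  congr <;> ext i <;> fin_cases i <;> rfl

theorem IsComplexMultilinear.sum_update_add_smul_J {n : ℕ} {J : V →ₗ[ℝ] V}
    {Ψ : V [⋀^Fin n]→ₗ[ℝ] ℂ} (hΨ : IsComplexMultilinear J Ψ) (A : V → V) (r : ℝ) (v : Fin n → V) :
    ∑ k, Ψ (Function.update v k (A (v k) + r • J (v k))) =
      ∑ k, Ψ (Function.update v k (A (v k))) + n * Complex.I * r * Ψ v := by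
  simp only [AlternatingMap.map_update_add, AlternatingMap.map_update_smul, hΨ v,
    Complex.real_smul, Finset.sum_add_distrib, Finset.sum_const, Finset.card_univ,
    Fintype.card_fin, nsmul_eq_mul]
  ring

section HermitianProduct

variable {J : V →ₗ[ℝ] V} {Ψ : V [⋀^Fin 3]→ₗ[ℝ] ℂ} {c : V ≃ₗ[ℝ] (Fin 3 → ℂ)}

/-- The Hermitian product `⟪·, ·⟫ + i ⟪·, J ·⟫`, complex linear in the first argument. -/
def hermitianInner (J : V →ₗ[ℝ] V) (u v : V) : ℂ := ⟨⟪u, v⟫, ⟪u, J v⟫⟩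

theorem IsOrthogonalComplexStructure.hermitianInner_sub_swap (hJ : IsOrthogonalComplexStructure J)
    (u v : V) : hermitianInner J u v - hermitianInner J v u = 2 * Complex.I * (⟪u, J v⟫ : ℝ) := by
  have : ⟪v, J u⟫ = -⟪u, J v⟫ := by rw [real_inner_comm, hJ.inner_J_left]
  simp [Complex.ext_iff, hermitianInner, this, real_inner_comm u v]
  ring

theorem IsUnitaryCoord.hermitianInner_eq {n : ℕ} {c : V ≃ₗ[ℝ] (Fin n → ℂ)}
    (hc : IsUnitaryCoord J c) (u v : V) :
    hermitianInner J u v = ∑ k, c u k * conj (c v k) := by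
  simp [Complex.ext_iff, hermitianInner, hc.inner_eq, hc.map_J]

/-- Lagrange's identity for the cross product of `ℂ³`. -/
theorem IsSpecialUnitaryCoord.sum_conj_Ψ_mul_Ψ (hc : IsSpecialUnitaryCoord J Ψ c) (u v x y : V) :
    ∑ k, conj (Ψ ![u, v, c.symm (Pi.single k 1)]) * Ψ ![c.symm (Pi.single k 1), x, y] =
      hermitianInner J x u * hermitianInner J y v -
        hermitianInner J x v * hermitianInner J y u := by
  simp [hc.hermitianInner_eq, hc.Ψ_apply, Fin.sum_univ_three]
  ring

end HermitianProduct

/-- The algebraic type of the torsion of a nearly Kähler structure: `ξ u` is skew and anticommutes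
with `J`, and `ξ u u = 0`. -/
structure IsNearlyKahlerTorsion (J : V →ₗ[ℝ] V) (ξ : V →ₗ[ℝ] Module.End ℝ V) : Prop where
  skew : ∀ u v w, ⟪ξ u v, w⟫ = -⟪v, ξ u w⟫
  map_J : ∀ u v, ξ u (J v) = -J (ξ u v)
  alt : ∀ u, ξ u u = 0

namespace IsNearlyKahlerTorsion

variable {J : V →ₗ[ℝ] V} {Ψ : V [⋀^Fin 3]→ₗ[ℝ] ℂ} {c : V ≃ₗ[ℝ] (Fin 3 → ℂ)}
  {ξ ξ' : V →ₗ[ℝ] Module.End ℝ V}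

theorem add (h : IsNearlyKahlerTorsion J ξ) (h' : IsNearlyKahlerTorsion J ξ') :
    IsNearlyKahlerTorsion J (ξ + ξ') where
  skew u v w := by
    simp only [LinearMap.add_apply, inner_add_left, inner_add_right, h.skew u v, h'.skew u v]
    ring
  map_J u v := by
    simp only [LinearMap.add_apply, h.map_J, h'.map_J, map_add]
    abel
  alt u := by simp [h.alt, h'.alt]

theorem swap (h : IsNearlyKahlerTorsion J ξ) (u v : V) : ξ u v = -ξ v u := by
  have := h.alt (u + v)
  simp only [map_add, LinearMap.add_apply, h.alt, zero_add, add_zero] at this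
  exact eq_neg_of_add_eq_zero_right this

theorem inner_swap₁₂ (h : IsNearlyKahlerTorsion J ξ) (hJ : IsOrthogonalComplexStructure J)
    (u v y : V) : ⟪ξ u v, J y⟫ = -⟪ξ u y, J v⟫ := by
  rw [h.skew, h.map_J, inner_neg_right, neg_neg, real_inner_comm, hJ.inner_J_left]

theorem inner_J₁ (h : IsNearlyKahlerTorsion J ξ) (hJ : IsOrthogonalComplexStructure J)
    (u v y : V) : ⟪ξ u (J v), J y⟫ = ⟪ξ u v, J (J y)⟫ := by
  rw [h.map_J, inner_neg_left, hJ.inner_J_J, hJ.J_J, inner_neg_right]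

theorem inner_J₀ (h : IsNearlyKahlerTorsion J ξ) (hJ : IsOrthogonalComplexStructure J)
    (u v y : V) : ⟪ξ (J u) v, J y⟫ = ⟪ξ u (J v), J y⟫ := by
  rw [h.swap (J u), inner_neg_left, h.inner_J₁ hJ, ← inner_neg_left, ← h.swap, h.inner_J₁ hJ]

theorem inner_add_smul_J (h : IsNearlyKahlerTorsion J ξ) (hJ : IsOrthogonalComplexStructure J)
    (u v y : V) (r : ℝ) :
    ⟪ξ u v + r • J v, J y⟫ + ⟪v, J (ξ u y + r • J y)⟫ = 2 * ⟪ξ u v, J y⟫ := by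
  have hvy : ⟪v, J (ξ u y)⟫ = ⟪ξ u v, J y⟫ := by rw [h.skew, h.map_J, inner_neg_right, neg_neg]
  rw [inner_add_left, real_inner_smul_left, hJ.inner_J_J, map_add, map_smul, hJ.J_J,
    inner_add_right, real_inner_smul_right, inner_neg_right, hvy]
  ring

/-- The complex multilinear form with real part `⟪ξ u v, J y⟫`. -/
def complexForm (h : IsNearlyKahlerTorsion J ξ) (hJ : IsOrthogonalComplexStructure J) :
    V [⋀^Fin 3]→ₗ[ℝ] ℂ :=
  alternatingOfSwap (fun u v y ↦ ⟨⟪ξ u v, J y⟫, -⟪ξ (J u) v, J y⟫⟩)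
    (fun _ _ _ _ ↦ by
      simp only [Complex.ext_iff, map_add, LinearMap.add_apply, inner_add_left, neg_add,
        Complex.add_re, Complex.add_im, and_self])
    (fun _ _ _ _ ↦ by simp [Complex.ext_iff, inner_smul_left])
    (fun u v y ↦ by
      rw [h.swap u v, h.inner_J₀ hJ u, h.swap u, inner_neg_left, inner_neg_left]
      simp [Complex.ext_iff])
    (fun u v y ↦ by
      rw [h.inner_swap₁₂ hJ u, h.inner_swap₁₂ hJ (J u)]
      simp [Complex.ext_iff])

theorem complexForm_isComplexMultilinear (h : IsNearlyKahlerTorsion J ξ)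
    (hJ : IsOrthogonalComplexStructure J) : IsComplexMultilinear J (h.complexForm hJ) :=
  .of_slot 0 fun v ↦ by
    change (⟨⟪ξ (J (v 0)) (v 1), J (v 2)⟫, -⟪ξ (J (J (v 0))) (v 1), J (v 2)⟫⟩ : ℂ) =
      Complex.I * ⟨⟪ξ (v 0) (v 1), J (v 2)⟫, -⟪ξ (J (v 0)) (v 1), J (v 2)⟫⟩
    simp [Complex.ext_iff, hJ.J_J]

theorem exists_eq (h : IsNearlyKahlerTorsion J ξ) (hJ : IsOrthogonalComplexStructure J)
    (hc : IsSpecialUnitaryCoord J Ψ c) :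
    ∃ w : ℂ, ∀ u v y, 2 * ⟪ξ u v, J y⟫ = (conj w * Ψ ![u, v, y]).re := by
  have hdet := hc.eq_mul_det (h.complexForm_isComplexMultilinear hJ)
  set z := h.complexForm hJ fun k ↦ c.symm (Pi.single k 1)
  refine ⟨conj (2 * z), fun u v y ↦ ?_⟩
  have := congrArg Complex.re (hdet ![u, v, y])
  rw [Complex.conj_conj, mul_assoc, ← Complex.ofReal_ofNat, Complex.re_ofReal_mul, hc.Ψ_eq, ← this]
  rfl

variable {w : ℂ}

theorem coord_eq (hJ : IsOrthogonalComplexStructure J) (hc : IsSpecialUnitaryCoord J Ψ c)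
    (hw : ∀ u v y, 2 * ⟪ξ u v, J y⟫ = (conj w * Ψ ![u, v, y]).re) (u v : V) (k : Fin 3) :
    c (ξ u v) k = Complex.I / 2 * w * conj (Ψ ![u, v, c.symm (Pi.single k 1)]) := by
  have h₁ := hw u v (c.symm (Pi.single k 1))
  have h₂ := hw u v (J (c.symm (Pi.single k 1)))
  rw [hJ.J_J, inner_neg_right, hc.isComplexMultilinear.map_J₂] at h₂
  rw [hc.coord_eq_inner]
  simp only [Complex.mul_re, Complex.conj_re, Complex.conj_im, Complex.mul_im, Complex.I_re,
    Complex.I_im] at h₁ h₂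
  apply Complex.ext <;> simp <;> linarith

theorem Ψ_torsion (hJ : IsOrthogonalComplexStructure J) (hc : IsSpecialUnitaryCoord J Ψ c)
    (hw : ∀ u v y, 2 * ⟪ξ u v, J y⟫ = (conj w * Ψ ![u, v, y]).re) (u v x y : V) :
    Ψ ![ξ u v, x, y] = Complex.I / 2 * w *
      (hermitianInner J x u * hermitianInner J y v -
        hermitianInner J x v * hermitianInner J y u) := by
  have hΨ : Ψ ![ξ u v, x, y] = ∑ k, c (ξ u v) k * Ψ ![c.symm (Pi.single k 1), x, y] := by
    simp [hc.Ψ_apply, Fin.sum_univ_three]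
    ring
  rw [hΨ, ← hc.sum_conj_Ψ_mul_Ψ, Finset.mul_sum]
  exact Finset.sum_congr rfl fun k _ ↦ by rw [coord_eq hJ hc hw, mul_assoc]

theorem re_conj_mul_eq (hJ : IsOrthogonalComplexStructure J) (hc : IsSpecialUnitaryCoord J Ψ c)
    (hw : ∀ u v y, 2 * ⟪ξ u v, J y⟫ = (conj w * Ψ ![u, v, y]).re) (u x y z : V) :
    (conj w * (Ψ ![ξ u x, y, z] + Ψ ![x, ξ u y, z] + Ψ ![x, y, ξ u z])).re =
      -(Complex.normSq w * (⟪u, x⟫ * ⟪y, J z⟫ - ⟪u, y⟫ * ⟪x, J z⟫ + ⟪u, z⟫ * ⟪x, J y⟫)) := by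
  have h₁ : Ψ ![x, ξ u y, z] = -Ψ ![ξ u y, x, z] := by rw [hc.Ψ_apply, hc.Ψ_apply]; ring
  have h₂ : Ψ ![x, y, ξ u z] = Ψ ![ξ u z, x, y] := by rw [hc.Ψ_apply, hc.Ψ_apply]; ring
  have hsum : conj w * (Ψ ![ξ u x, y, z] + Ψ ![x, ξ u y, z] + Ψ ![x, y, ξ u z]) =
      -(Complex.normSq w * (hermitianInner J x u * (⟪y, J z⟫ : ℝ)
        - hermitianInner J y u * (⟪x, J z⟫ : ℝ) + hermitianInner J z u * (⟪x, J y⟫ : ℝ))) := by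
    rw [h₁, h₂, Ψ_torsion hJ hc hw, Ψ_torsion hJ hc hw, Ψ_torsion hJ hc hw,
      Complex.normSq_eq_conj_mul_self]
    linear_combination
      conj w * w * Complex.I / 2 * (hermitianInner J x u * hJ.hermitianInner_sub_swap y z
        - hermitianInner J y u * hJ.hermitianInner_sub_swap x z
        + hermitianInner J z u * hJ.hermitianInner_sub_swap x y)
      + conj w * w * (hermitianInner J x u * (⟪y, J z⟫ : ℝ)
        - hermitianInner J y u * (⟪x, J z⟫ : ℝ) + hermitianInner J z u * (⟪x, J y⟫ : ℝ))
        * Complex.I_mul_I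
  rw [hsum]
  simp [hermitianInner, real_inner_comm u]

theorem eq_zero (hJ : IsOrthogonalComplexStructure J)
    (hw : ∀ u v y, 2 * ⟪ξ u v, J y⟫ = (conj w * Ψ ![u, v, y]).re) (h0 : w = 0) : ξ = 0 := by
  ext u v
  refine ext_inner_right ℝ fun y ↦ ?_
  have := hw u v (J y)
  simpa [h0, hJ.J_J] using this

end IsNearlyKahlerTorsion

end TorsionAlgebra

noncomputable section TorsionPointwise

open scoped ComplexConjugate

local notation "⟪" u ", " v "⟫" => inner ℝ u v

namespace SU3Structure

variable {M : Type*} [TopologicalSpace M] [ChartedSpace E6 M] [IsManifold (𝓡 6) ∞ M]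
  [RiemannianBundle (fun x : M ↦ TangentSpace (𝓡 6) x)]

variable (S : SU3Structure M) {x : M}

/-- The almost complex structure as a linear endomorphism of the tangent space at `x`. -/
abbrev Jlin (x : M) : TangentSpace (𝓡 6) x →ₗ[ℝ] TangentSpace (𝓡 6) x := S.J x

theorem isOrthogonalComplexStructure (x : M) : IsOrthogonalComplexStructure (S.Jlin x) :=
  ⟨S.J_J x, S.inner_J_J x⟩

theorem isComplexMultilinear (x : M) : IsComplexMultilinear (S.Jlin x) (S.Ψ x) :=
  .of_slot 0 fun v ↦ by
    convert S.Ψ_J x (v 0) (v 1) (v 2) using 3 <;> ext i <;> fin_cases i <;> rfl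

theorem normSq_Ψ {c : TangentSpace (𝓡 6) x ≃ₗ[ℝ] (Fin 3 → ℂ)} (hc : IsUnitaryCoord (S.Jlin x) c) :
    Complex.normSq (S.Ψ x fun k ↦ c.symm (Pi.single k 1)) = 1 := by
  have hdet := hc.eq_mul_det (S.isComplexMultilinear x)
  set z := S.Ψ x fun k ↦ c.symm (Pi.single k 1)
  have h := S.Ψ_norm x (fun k ↦ c.symm (Pi.single k 1)) fun i j ↦ by
    have hi := hc.isUnitaryFrame.inner_eq i j
    have hJ : ⟪c.symm (Pi.single i 1), S.J x (c.symm (Pi.single j 1))⟫ = 0 :=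
      hc.isUnitaryFrame.inner_J_eq i j
    rw [hi, hJ]
    split_ifs <;> simp
  have hsum : 1 / (Nat.factorial 3 : ℂ) * (6 * (z * conj z)) = 1 := by
    refine Eq.trans (congrArg _ ?_) h
    simp only [hdet, Pi.basisFun_det_apply, Matrix.det_fin_three, Fin.sum_univ_three]
    simp
    ring
  have hz : (Complex.normSq z : ℂ) = 1 := by
    rw [← Complex.mul_conj, ← hsum]
    simp [Nat.factorial]
  exact_mod_cast hz

theorem exists_isSpecialUnitaryCoord (x : M) :
    ∃ c : TangentSpace (𝓡 6) x ≃ₗ[ℝ] (Fin 3 → ℂ), IsSpecialUnitaryCoord (S.Jlin x) (S.Ψ x) c := by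
  have hdim : Module.finrank ℝ (TangentSpace (𝓡 6) x) = 2 * 3 :=
    (finrank_euclideanSpace_fin : Module.finrank ℝ E6 = 6)
  have hJ := S.isOrthogonalComplexStructure x
  obtain ⟨e, he⟩ := hJ.exists_isUnitaryFrame hdim.ge
  obtain ⟨c, hc, -⟩ := he.exists_isUnitaryCoord hJ hdim
  exact hc.exists_isSpecialUnitaryCoord (S.isComplexMultilinear x) (S.normSq_Ψ hc)

theorem torsionForm_eq (ξ : Torsion x) (u v y : TangentSpace (𝓡 6) x) :
    S.torsionForm x ξ u v y = ⟪ξ u v, S.Jlin x y⟫ + ⟪v, S.Jlin x (ξ u y)⟫ := by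
  simp [torsionForm, endAction, kahlerForm, Fin.sum_univ_two, Function.update]

theorem isNearlyKahlerTorsion_of_mem_W1 {ξ : Torsion x} (h : ξ ∈ S.W1 x) :
    IsNearlyKahlerTorsion (S.Jlin x) ξ := by
  have hJ := S.isOrthogonalComplexStructure x
  have hskew (u v y) : ⟪ξ u v, y⟫ = -⟪v, ξ u y⟫ := (h.1 u).1 v y
  have hanti (u v) : ξ u (S.Jlin x v) = -S.Jlin x (ξ u v) :=
    hJ.map_J_eq_neg (hskew u) (fun B hB hBJ ↦ (h.1 u).2 B ⟨hB, hBJ⟩) v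
  refine ⟨hskew, hanti, fun u ↦ ext_inner_right ℝ fun y ↦ ?_⟩
  have halt := h.2 u (S.Jlin x y)
  rw [torsionForm_eq, hanti, map_neg, hJ.J_J, hJ.J_J, neg_neg, inner_neg_right,
    ← neg_eq_iff_eq_neg.2 (hskew u u y)] at halt
  rw [inner_zero_left]
  linarith

/-- The derivation `Ψ ↦ ∑ₖ Ψ(…, (ξ_u + η(u) J) aₖ, …)`, which is `∇_u Ψ` if `ξ + η ⊗ J` is the
intrinsic torsion. -/
def torsionΨ (x : M) (ξ : Torsion x) (η : TangentSpace (𝓡 6) x →ₗ[ℝ] ℝ)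
    (u : TangentSpace (𝓡 6) x) (a : Fin 3 → TangentSpace (𝓡 6) x) : ℂ :=
  ∑ k, S.Ψ x (Function.update a k (ξ u (a k))) + 3 * Complex.I * η u * S.Ψ x a

theorem sum_update_torsion (ξ : Torsion x) (η : TangentSpace (𝓡 6) x →ₗ[ℝ] ℝ)
    (u : TangentSpace (𝓡 6) x) (a : Fin 3 → TangentSpace (𝓡 6) x) :
    ∑ k, S.Ψ x (Function.update a k ((ξ + η.smulRight (S.Jlin x)) u (a k))) =
      S.torsionΨ x ξ η u a :=
  (S.isComplexMultilinear x).sum_update_add_smul_J (ξ u) (η u) a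

variable [IsContMDiffRiemannianBundle (𝓡 6) ∞ E6 (fun x : M ↦ TangentSpace (𝓡 6) x)]

/-- The intrinsic torsion at `x` is `ξ + η ⊗ J`, where `ξ` is of nearly Kähler type and corresponds
to the three-form `Re(w̄Ψ)`. -/
structure HasTorsion (x : M) (w : ℂ) (ξ : Torsion x) (η : TangentSpace (𝓡 6) x →ₗ[ℝ] ℝ) :
    Prop where
  isIntrinsicTorsion : S.IsIntrinsicTorsion x (ξ + η.smulRight (S.Jlin x))
  isNearlyKahlerTorsion : IsNearlyKahlerTorsion (S.Jlin x) ξ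
  inner_eq : ∀ u v y, 2 * ⟪ξ u v, S.Jlin x y⟫ = (conj w * S.Ψ x ![u, v, y]).re

theorem exists_hasTorsion {T : Torsion x} (hT : S.IsIntrinsicTorsion x T)
    (hmem : T ∈ S.W1pW1mW5 x) : ∃ w ξ η, S.HasTorsion x w ξ η := by
  obtain ⟨ξp, hξp, ξm, hξm, η', ⟨η, hη⟩, rfl⟩ := hmem
  obtain ⟨c, hc⟩ := S.exists_isSpecialUnitaryCoord x
  have hξ := (S.isNearlyKahlerTorsion_of_mem_W1 hξp.1).add (S.isNearlyKahlerTorsion_of_mem_W1 hξm.1)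
  obtain ⟨w, hw⟩ := hξ.exists_eq (S.isOrthogonalComplexStructure x) hc
  obtain rfl : η' = η.smulRight (S.Jlin x) := LinearMap.ext₂ hη
  exact ⟨w, ξp + ξm, η, hT, hξ, hw⟩

namespace HasTorsion

variable {S} {w : ℂ} {ξ : Torsion x} {η : TangentSpace (𝓡 6) x →ₗ[ℝ] ℝ}

theorem covDerivForm_kahlerForm (h : S.HasTorsion x w ξ η) (u v y : TangentSpace (𝓡 6) x) :
    covDerivForm S.kahlerForm x u ![v, y] = (conj w * S.Ψ x ![u, v, y]).re := by
  rw [← h.inner_eq, ← h.isNearlyKahlerTorsion.inner_add_smul_J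
    (S.isOrthogonalComplexStructure x) u v y (η u)]
  refine (eq_neg_of_add_eq_zero_left (h.isIntrinsicTorsion.parallel_kahlerForm u ![v, y])).trans ?_
  exact S.torsionForm_eq _ u v y

theorem covDerivForm_ψp (h : S.HasTorsion x w ξ η) (u : TangentSpace (𝓡 6) x)
    (a : Fin 3 → TangentSpace (𝓡 6) x) :
    covDerivForm S.ψp x u a = (S.torsionΨ x ξ η u a).re := by
  rw [← S.sum_update_torsion, Complex.re_sum]
  exact add_neg_eq_zero.1 (h.isIntrinsicTorsion.parallel_ψp u a)

theorem covDerivForm_ψm (h : S.HasTorsion x w ξ η) (u : TangentSpace (𝓡 6) x)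
    (a : Fin 3 → TangentSpace (𝓡 6) x) :
    covDerivForm S.ψm x u a = (S.torsionΨ x ξ η u a).im := by
  rw [← S.sum_update_torsion, Complex.im_sum]
  exact add_neg_eq_zero.1 (h.isIntrinsicTorsion.parallel_ψm u a)

theorem exists_mem_W5 (h : S.HasTorsion x w ξ η) (hw : w = 0) :
    ∃ T, S.IsIntrinsicTorsion x T ∧ T ∈ S.W5 x := by
  refine ⟨_, h.isIntrinsicTorsion, η, fun u v ↦ ?_⟩
  rw [IsNearlyKahlerTorsion.eq_zero (S.isOrthogonalComplexStructure x) h.inner_eq hw, zero_add]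
  rfl

end HasTorsion

end SU3Structure

end TorsionPointwise

section ComplexValued

variable {E : Type*} [NormedAddCommGroup E] [NormedSpace ℝ E]
  {H : Type*} [TopologicalSpace H] {I : ModelWithCorners ℝ E H}
  {M : Type*} [TopologicalSpace M] [ChartedSpace H M] {x : M}

theorem contMDiffAt_complex_div {f g : M → ℂ} (hf : ContMDiffAt I 𝓘(ℝ, ℂ) ∞ f x)
    (hg : ContMDiffAt I 𝓘(ℝ, ℂ) ∞ g x) (h : g x ≠ 0) :
    ContMDiffAt I 𝓘(ℝ, ℂ) ∞ (fun y ↦ f y / g y) x := by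
  have hdiv : ContDiffAt ℝ ∞ (fun p : ℂ × ℂ ↦ p.1 * p.2⁻¹) (f x, g x) :=
    contDiffAt_fst.mul (contDiffAt_snd.inv h)
  exact hdiv.contMDiffAt.comp x (hf.prodMk_space hg)

theorem contMDiffAt_of_re_mul {z D : M → ℂ} (hD : ContMDiffAt I 𝓘(ℝ, ℂ) ∞ D x) (hD0 : D x ≠ 0)
    (h₁ : CMDiffAt ∞ (fun y ↦ (z y * D y).re) x)
    (h₂ : CMDiffAt ∞ (fun y ↦ (z y * (Complex.I * D y)).re) x) :
    ContMDiffAt I 𝓘(ℝ, ℂ) ∞ z x := by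
  have hzD : ContMDiffAt I 𝓘(ℝ, ℂ) ∞ (fun y ↦ z y * D y) x := by
    convert Complex.equivRealProdCLM.symm.contDiff.contMDiff.contMDiffAt.comp x
      (h₁.prodMk_space h₂.neg) using 2 with y
    apply Complex.ext
    · simp
    · simp [add_comm]
  refine (contMDiffAt_complex_div hzD hD hD0).congr_of_eventuallyEq ?_
  filter_upwards [hD.continuousAt.eventually_ne hD0] with y hy
  exact (mul_div_cancel_right₀ _ hy).symm

end ComplexValued

noncomputable section TorsionDerivative

open scoped ComplexConjugate

local notation "⟪" u ", " v "⟫" => inner ℝ u v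

namespace SU3Structure

variable {M : Type*} [TopologicalSpace M] [ChartedSpace E6 M] [IsManifold (𝓡 6) ∞ M]
  [RiemannianBundle (fun x : M ↦ TangentSpace (𝓡 6) x)]

variable (S : SU3Structure M) {x : M}

theorem contMDiffAt_J {X : Π y : M, TangentSpace (𝓡 6) y}
    (hX : ContMDiffAt (𝓡 6) (𝓡 6).tangent ∞ (T% X) x) :
    ContMDiffAt (𝓡 6) (𝓡 6).tangent ∞ (T% (fun y ↦ S.J y (X y))) x :=
  ContMDiffAt.clm_bundle_apply (F₁ := E6) (F₂ := E6) (E₁ := fun x : M ↦ TangentSpace (𝓡 6) x)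
    (E₂ := fun x : M ↦ TangentSpace (𝓡 6) x) (b := id) (S.contMDiff_J x) hX

/-- The Kähler form as a multilinear map. -/
def kahlerMultilinear (y : M) : MultilinearMap ℝ (fun _ : Fin 2 ↦ TangentSpace (𝓡 6) y) ℝ :=
  bilinToMultilinear ((innerₗ (TangentSpace (𝓡 6) y)).compl₂ (S.Jlin y))

theorem isSmoothForm_ψp : IsSmoothForm S.ψp := fun y V hV ↦
  Complex.reCLM.contMDiff.contMDiffAt.comp y (S.contMDiff_Ψ V y hV)

theorem isSmoothForm_ψm : IsSmoothForm S.ψm := fun y V hV ↦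
  Complex.imCLM.contMDiff.contMDiffAt.comp y (S.contMDiff_Ψ V y hV)

/-- The three-form `Re(w̄Ψ)`. -/
def volRe (w : M → ℂ) (y : M) : MultilinearMap ℝ (fun _ : Fin 3 ↦ TangentSpace (𝓡 6) y) ℝ :=
  (w y).re • Complex.reLm.compMultilinearMap (S.Ψ y).toMultilinearMap
    + (w y).im • Complex.imLm.compMultilinearMap (S.Ψ y).toMultilinearMap

theorem volRe_eq (w : M → ℂ) (y : M) (a : Fin 3 → TangentSpace (𝓡 6) y) :
    S.volRe w y a = (w y).re * S.ψp y a + (w y).im * S.ψm y a := rfl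

theorem volRe_eq_re (w : M → ℂ) (y : M) (a : Fin 3 → TangentSpace (𝓡 6) y) :
    S.volRe w y a = (conj (w y) * S.Ψ y a).re := by
  simp [volRe_eq, ψp, ψm]

variable [IsContMDiffRiemannianBundle (𝓡 6) ∞ E6 (fun x : M ↦ TangentSpace (𝓡 6) x)]

theorem isSmoothForm_kahlerForm : IsSmoothForm S.kahlerForm := fun _ _ hV ↦
  contMDiffAt_inner (hV 0) (S.contMDiffAt_J (hV 1))

variable {S} {w : M → ℂ} {ξ : Π x : M, Torsion x} {η : Π x : M, TangentSpace (𝓡 6) x →ₗ[ℝ] ℝ}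

theorem hasCovDeriv_kahlerForm (h : ∀ x, S.HasTorsion x (w x) (ξ x) (η x)) :
    HasCovDeriv S.kahlerForm fun y ↦ S.volRe w y := by
  refine (IsSmoothForm.hasCovDeriv (φ := S.kahlerMultilinear) S.isSmoothForm_kahlerForm).congr
    fun y v ↦ ?_
  have hv : v = ![v 0, v 1, v 2] := by ext i; fin_cases i <;> rfl
  rw [S.volRe_eq_re, hv]
  exact (h y).covDerivForm_kahlerForm (v 0) (v 1) (v 2)

theorem hasCovDeriv_ψp (h : ∀ x, S.HasTorsion x (w x) (ξ x) (η x)) :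
    HasCovDeriv S.ψp fun y v ↦ (S.torsionΨ y (ξ y) (η y) (v 0) (Matrix.vecTail v)).re :=
  (IsSmoothForm.hasCovDeriv (φ := fun y ↦ Complex.reLm.compMultilinearMap
    (S.Ψ y).toMultilinearMap) S.isSmoothForm_ψp).congr fun y _ ↦ (h y).covDerivForm_ψp _ _

theorem hasCovDeriv_ψm (h : ∀ x, S.HasTorsion x (w x) (ξ x) (η x)) :
    HasCovDeriv S.ψm fun y v ↦ (S.torsionΨ y (ξ y) (η y) (v 0) (Matrix.vecTail v)).im :=
  (IsSmoothForm.hasCovDeriv (φ := fun y ↦ Complex.imLm.compMultilinearMap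
    (S.Ψ y).toMultilinearMap) S.isSmoothForm_ψm).congr fun y _ ↦ (h y).covDerivForm_ψm _ _

theorem contMDiffAt_w (h : ∀ x, S.HasTorsion x (w x) (ξ x) (η x)) (x : M) :
    ContMDiffAt (𝓡 6) 𝓘(ℝ, ℂ) ∞ w x := by
  obtain ⟨c, hc⟩ := S.exists_isSpecialUnitaryCoord x
  let e (k : Fin 3) : TangentSpace (𝓡 6) x := c.symm (Pi.single k 1)
  let X (k : Fin 3) : Π y : M, TangentSpace (𝓡 6) y := extend E6 (e k)
  have hX (k : Fin 3) : SmoothNear x (X k) := SmoothNear.extend (e k)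
  have hJX : SmoothNear x fun y ↦ S.J y (X 0 y) := (hX 0).mono fun y ↦ S.contMDiffAt_J
  have hD := S.contMDiff_Ψ X x fun k ↦ (hX k).contMDiffAt
  have hD0 : S.Ψ x (fun k ↦ X k x) ≠ 0 := by
    simp only [X, extend_apply_self]
    rw [hc.Ψ_frame]
    exact one_ne_zero
  have hre {U : Π y : M, TangentSpace (𝓡 6) y} (hU : SmoothNear x U) :
      ContMDiffAt (𝓡 6) 𝓘(ℝ, ℝ) ∞
        (fun y ↦ (conj (w y) * S.Ψ y (Function.update (fun k ↦ X k y) 0 (U y))).re) x := by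
    convert (hasCovDeriv_kahlerForm h).contMDiffAt S.isSmoothForm_kahlerForm hU
      fun i ↦ hX i.succ using 2 with y
    rw [S.volRe_eq_re]
    congr 3
    funext i
    exact Fin.cases rfl (fun _ ↦ rfl) i
  have hconj : ContMDiffAt (𝓡 6) 𝓘(ℝ, ℂ) ∞ (fun y ↦ conj (w y)) x := by
    refine contMDiffAt_of_re_mul hD hD0 ?_ ?_
    · simpa only [Function.update_eq_self] using hre (hX 0)
    · simp only [← S.isComplexMultilinear _ _ 0]
      exact hre hJX
  simpa only [Function.comp_def, Complex.conjCLE_apply, Complex.conj_conj] using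
    Complex.conjCLE.contDiff.contMDiff.contMDiffAt.comp x hconj

end SU3Structure

end TorsionDerivative

noncomputable section RiemannTensor

variable {E : Type*} [NormedAddCommGroup E] [NormedSpace ℝ E] [FiniteDimensional ℝ E]
  {H : Type*} [TopologicalSpace H] {I : ModelWithCorners ℝ E H}
  {M : Type*} [TopologicalSpace M] [ChartedSpace H M] [IsManifold I ∞ M]
  [RiemannianBundle (fun x : M ↦ TangentSpace I x)]
  [IsContMDiffRiemannianBundle I ∞ E (fun x : M ↦ TangentSpace I x)] {x : M}

local notation "⟪" u ", " v "⟫" => inner ℝ u v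

variable (I M) in
/-- The Riemann curvature tensor `⟨R_{u,v} y, z⟩` at `x`. -/
def riemann (x : M) (u v y z : TangentSpace I x) : ℝ := ⟪curvature I M x u v y, z⟫

variable [I.Boundaryless]

theorem isAlgebraicCurvature_riemann : IsAlgebraicCurvature (riemann I M x) where
  swap₁₂ u v y z := by rw [riemann, riemann, curvature_swap, inner_neg_left]
  swap₃₄ := inner_curvature_skew
  bianchi u v y z := by
    simp only [riemann]
    rw [← inner_add_left, ← inner_add_left, curvature_bianchi, inner_zero_left]
  add₄ _ _ _ _ _ := inner_add_right _ _ _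
  smul₄ _ _ _ _ _ := inner_smul_right _ _ _

/-- The difference of the curvature operator `R_{u,v}` and that of a sphere of curvature `α`. -/
def curvatureSubSphere (α : ℝ) (u v : TangentSpace I x) :
    TangentSpace I x →ₗ[ℝ] TangentSpace I x where
  toFun y := curvature I M x u v y - (α * ⟪u, y⟫) • v + (α * ⟪v, y⟫) • u
  map_add' y y' := by
    have h : curvature I M x u v (y + y') = curvature I M x u v y + curvature I M x u v y' :=
      ext_inner_right ℝ fun z ↦ by
        rw [inner_add_left]
        exact isAlgebraicCurvature_riemann.add₃ u v y y' z
    simp only [h, inner_add_right, mul_add, add_smul]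
    abel
  map_smul' r y := by
    have h : curvature I M x u v (r • y) = r • curvature I M x u v y :=
      ext_inner_right ℝ fun z ↦ by
        rw [real_inner_smul_left]
        exact isAlgebraicCurvature_riemann.smul₃ u v r y z
    simp only [h, real_inner_smul_right, RingHom.id_apply]
    module

theorem curvatureSubSphere_apply (α : ℝ) (u v y : TangentSpace I x) :
    curvatureSubSphere α u v y =
      curvature I M x u v y - (α * ⟪u, y⟫) • v + (α * ⟪v, y⟫) • u := rfl

theorem inner_curvatureSubSphere (α : ℝ) (u v y z : TangentSpace I x) :
    ⟪curvatureSubSphere α u v y, z⟫ = riemann I M x u v y z - α * sphereCurvature u v y z := by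
  simp only [curvatureSubSphere_apply, inner_add_left, inner_sub_left, real_inner_smul_left,
    riemann, sphereCurvature]
  ring

end RiemannTensor

section SphereCurvatureTrace

local notation "⟪" u ", " v "⟫" => inner ℝ u v

variable {V : Type*} [NormedAddCommGroup V] [InnerProductSpace ℝ V] {J : V →ₗ[ℝ] V}
  {K : V → V → V → V → ℝ} {α : ℝ} {ι : Type*} [Fintype ι]

theorem sum_sphereCurvature (b : OrthonormalBasis ι ℝ V) (u v : V) :
    ∑ i, sphereCurvature u (b i) v (b i) = (Fintype.card ι - 1) * ⟪u, v⟫ := by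
  have hbb (i : ι) : ⟪b i, b i⟫ = 1 := by simp
  simp only [sphereCurvature, Finset.sum_sub_distrib, hbb, b.sum_inner_mul_inner, mul_one,
    Finset.sum_const, Finset.card_univ, nsmul_eq_mul]
  ring

theorem sum_sphereCurvature_J_J (hJ : IsOrthogonalComplexStructure J) (b : OrthonormalBasis ι ℝ V)
    (u v : V) : ∑ i, sphereCurvature u (b i) (J v) (J (b i)) = ⟪u, v⟫ := by
  have hterm (i : ι) : sphereCurvature u (b i) (J v) (J (b i)) = ⟪J u, b i⟫ * ⟪b i, J v⟫ := by
    rw [sphereCurvature, hJ.inner_J_self, hJ.inner_J_left]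
    ring
  simp only [hterm, b.sum_inner_mul_inner, hJ.inner_J_J]

theorem IsAlgebraicCurvature.ricci_eq_of_sub_sphereCurvature (hK : IsAlgebraicCurvature K)
    (hJ : IsOrthogonalComplexStructure J)
    (h : ∀ u v y z, K u v y (J z) - α * sphereCurvature u v y (J z)
      + (K u v (J y) z - α * sphereCurvature u v (J y) z) = 0) (b : OrthonormalBasis ι ℝ V)
    (htr : ∀ u v, ∑ i, (K u v (b i) (J (b i)) - α * sphereCurvature u v (b i) (J (b i))) = 0)
    (u v : V) :
    ∑ i, K u (b i) v (b i) = α * ((Fintype.card ι - 1) * ⟪u, v⟫) ∧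
      ∑ i, K u (b i) (J v) (J (b i)) = α * ⟪u, v⟫ := by
  have hflat := (hK.sub_sphereCurvature α).ricci_eq_zero hJ h b htr u v
  have hflatJ : ∑ i, (K u (b i) (J v) (J (b i))
      - α * sphereCurvature u (b i) (J v) (J (b i))) = 0 := by
    rw [← hflat]
    exact Finset.sum_congr rfl fun i _ ↦ (hK.sub_sphereCurvature α).map_J_J hJ h u (b i) v (b i)
  rw [Finset.sum_sub_distrib, sub_eq_zero, ← Finset.mul_sum] at hflat hflatJ
  rw [hflat, hflatJ, sum_sphereCurvature, sum_sphereCurvature_J_J hJ]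
  exact ⟨rfl, rfl⟩

end SphereCurvatureTrace

noncomputable section NearlyKahlerCurvature

open scoped ComplexConjugate

local notation "⟪" u ", " v "⟫" => inner ℝ u v

namespace SU3Structure

variable {M : Type*} [TopologicalSpace M] [ChartedSpace E6 M] [IsManifold (𝓡 6) ∞ M]
  [RiemannianBundle (fun x : M ↦ TangentSpace (𝓡 6) x)]

variable (S : SU3Structure M) {x : M}

/-- The four-tensor `⟨v₀, ·⟩ ∧ ω`, whose first argument is not skew-symmetrized. -/
def wedgeKahler (x : M) (v : Fin 4 → TangentSpace (𝓡 6) x) : ℝ :=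
  ⟪v 0, v 1⟫ * ⟪v 2, S.J x (v 3)⟫ - ⟪v 0, v 2⟫ * ⟪v 1, S.J x (v 3)⟫
    + ⟪v 0, v 3⟫ * ⟪v 1, S.J x (v 2)⟫

/-- The one-form `β` with `∇ Re(w̄Ψ) = -|w|² ⟨·, ·⟩ ∧ ω + Re(βΨ)`. -/
def volReDeriv (w : M → ℂ) (η : Π x : M, TangentSpace (𝓡 6) x →ₗ[ℝ] ℝ) (x : M) :
    TangentSpace (𝓡 6) x →ₗ[ℝ] ℂ where
  toFun u := ⟨mvfderiv (𝓡 6) (fun y ↦ (w y).re) x u + 3 * η x u * (w x).im,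
    -mvfderiv (𝓡 6) (fun y ↦ (w y).im) x u + 3 * η x u * (w x).re⟩
  map_add' u v := by
    apply Complex.ext <;> simp <;> ring
  map_smul' r u := by
    apply Complex.ext <;> simp <;> ring

theorem sum_mul_volRe_update (w : M → ℂ) (r : Fin 3 → ℝ) (a : Fin 3 → TangentSpace (𝓡 6) x)
    (u : TangentSpace (𝓡 6) x) :
    ∑ k, r k * S.volRe w x (Function.update a k u) = r 0 * S.volRe w x ![u, a 1, a 2]
      - r 1 * S.volRe w x ![u, a 0, a 2] + r 2 * S.volRe w x ![u, a 0, a 1] := by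
  have hupdate (k) : S.volRe w x (Function.update a k u) =
      (-1) ^ (k : ℕ) * S.volRe w x (Matrix.vecCons u (k.removeNth a)) := by
    have hΨ : S.Ψ x (Function.update a k u) =
        ((-1) ^ (k : ℕ) : ℝ) * S.Ψ x (Matrix.vecCons u (k.removeNth a)) := by
      rw [← Fin.insertNth_removeNth, AlternatingMap.map_insertNth]
      simp
    rw [S.volRe_eq_re, S.volRe_eq_re, hΨ, mul_left_comm, Complex.re_ofReal_mul]
  have hremove : (0 : Fin 3).removeNth a = ![a 1, a 2] ∧ (1 : Fin 3).removeNth a = ![a 0, a 2] ∧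
      (2 : Fin 3).removeNth a = ![a 0, a 1] := by
    refine ⟨?_, ?_, ?_⟩ <;> ext i <;> fin_cases i <;> rfl
  simp only [Fin.sum_univ_three, hupdate, hremove]
  simp
  ring

variable [IsContMDiffRiemannianBundle (𝓡 6) ∞ E6 (fun x : M ↦ TangentSpace (𝓡 6) x)]

variable {S}

theorem HasTorsion.re_conj_mul_torsionΨ {w : ℂ} {ξ : Torsion x}
    {η : TangentSpace (𝓡 6) x →ₗ[ℝ] ℝ} (h : S.HasTorsion x w ξ η) (u : TangentSpace (𝓡 6) x)
    (a : Fin 3 → TangentSpace (𝓡 6) x) :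
    (conj w * S.torsionΨ x ξ η u a).re =
      -(Complex.normSq w * S.wedgeKahler x (Matrix.vecCons u a))
      + 3 * η u * (w.im * S.ψp x a - w.re * S.ψm x a) := by
  obtain ⟨c, hc⟩ := S.exists_isSpecialUnitaryCoord x
  have ha : a = ![a 0, a 1, a 2] := by ext i; fin_cases i <;> rfl
  have hξ := IsNearlyKahlerTorsion.re_conj_mul_eq (S.isOrthogonalComplexStructure x) hc h.inner_eq
    u (a 0) (a 1) (a 2)
  rw [← sum_update_three (S.Ψ x) (ξ u), ← ha] at hξ
  rw [torsionΨ, mul_add, Complex.add_re, hξ]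
  congr 1
  simp [ψp, ψm]
  ring

variable {w : M → ℂ} {ξ : Π x : M, Torsion x} {η : Π x : M, TangentSpace (𝓡 6) x →ₗ[ℝ] ℝ}

theorem contMDiff_re_w (h : ∀ x, S.HasTorsion x (w x) (ξ x) (η x)) :
    ContMDiff (𝓡 6) 𝓘(ℝ, ℝ) ∞ fun y ↦ (w y).re :=
  fun x ↦ Complex.reCLM.contMDiff.contMDiffAt.comp x (contMDiffAt_w h x)

theorem contMDiff_im_w (h : ∀ x, S.HasTorsion x (w x) (ξ x) (η x)) :
    ContMDiff (𝓡 6) 𝓘(ℝ, ℝ) ∞ fun y ↦ (w y).im :=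
  fun x ↦ Complex.imCLM.contMDiff.contMDiffAt.comp x (contMDiffAt_w h x)

theorem isSmoothForm_volRe (h : ∀ x, S.HasTorsion x (w x) (ξ x) (η x)) :
    IsSmoothForm fun y ↦ S.volRe w y := fun x V hV ↦
  ((contMDiff_re_w h x).mul (S.isSmoothForm_ψp x V hV)).add
    ((contMDiff_im_w h x).mul (S.isSmoothForm_ψm x V hV))

theorem hasCovDeriv_volRe (h : ∀ x, S.HasTorsion x (w x) (ξ x) (η x)) :
    HasCovDeriv (fun y ↦ S.volRe w y) fun y v ↦ -(Complex.normSq (w y) * S.wedgeKahler y v)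
      + (volReDeriv w η y (v 0) * S.Ψ y (Matrix.vecTail v)).re := by
  have hp (y) := (contMDiff_re_w h y).mdifferentiableAt (n := ∞) (by simp)
  have hm (y) := (contMDiff_im_w h y).mdifferentiableAt (n := ∞) (by simp)
  refine (((hasCovDeriv_ψp h).fun_mul hp).add ((hasCovDeriv_ψm h).fun_mul hm)).congr fun y v ↦ ?_
  have hv : Matrix.vecCons (v 0) (Matrix.vecTail v) = v := Matrix.cons_head_tail v
  have htorsion := (h y).re_conj_mul_torsionΨ (v 0) (Matrix.vecTail v)
  rw [hv, Complex.mul_re, Complex.conj_re, Complex.conj_im] at htorsion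
  simp only [volReDeriv, LinearMap.coe_mk, AddHom.coe_mk, Complex.mul_re, ψp, ψm] at htorsion ⊢
  linear_combination htorsion

theorem ricci_identity_kahlerForm (h : ∀ x, S.HasTorsion x (w x) (ξ x) (η x))
    (u v a b : TangentSpace (𝓡 6) x) :
    riemann (𝓡 6) M x u v a (S.Jlin x b)
        - Complex.normSq (w x) * sphereCurvature u v a (S.Jlin x b)
      + (riemann (𝓡 6) M x u v (S.Jlin x a) b
        - Complex.normSq (w x) * sphereCurvature u v (S.Jlin x a) b) =
      (volReDeriv w η x u * S.Ψ x ![v, a, b] - volReDeriv w η x v * S.Ψ x ![u, a, b]).re := by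
  have hJ := S.isOrthogonalComplexStructure x
  have hricci := (hasCovDeriv_kahlerForm h).ricci_identity (φ := S.kahlerMultilinear)
    S.isSmoothForm_kahlerForm (hasCovDeriv_volRe h) u v ![a, b]
  have hleft : ∑ i, S.kahlerMultilinear x
      (Function.update ![a, b] i (curvature (𝓡 6) M x u v (![a, b] i))) =
      riemann (𝓡 6) M x u v a (S.Jlin x b) + riemann (𝓡 6) M x u v (S.Jlin x a) b := by
    have hb : ⟪a, S.Jlin x (curvature (𝓡 6) M x u v b)⟫ = riemann (𝓡 6) M x u v (S.Jlin x a) b := by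
      rw [← neg_eq_iff_eq_neg.2 (hJ.inner_J_left a _), real_inner_comm, riemann,
        inner_curvature_skew, neg_neg]
    rw [Fin.sum_univ_two, ← hb]
    rfl
  rw [hleft] at hricci
  rw [Complex.sub_re]
  have hwedge : S.wedgeKahler x ![u, v, a, b] - S.wedgeKahler x ![v, u, a, b] =
      -(sphereCurvature u v a (S.Jlin x b) + sphereCurvature u v (S.Jlin x a) b) := by
    simp [wedgeKahler, sphereCurvature, real_inner_comm u v]
    ring
  simp only [Matrix.cons_val_zero, Matrix.tail_cons] at hricci
  linear_combination hricci - Complex.normSq (w x) * hwedge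

theorem volReDeriv_eq_zero (h : ∀ x, S.HasTorsion x (w x) (ξ x) (η x)) (x : M) :
    volReDeriv w η x = 0 := by
  obtain ⟨c, hc⟩ := S.exists_isSpecialUnitaryCoord x
  exact hc.eq_zero_of_curvature (S.isOrthogonalComplexStructure x)
    (isAlgebraicCurvature_riemann.sub_sphereCurvature (Complex.normSq (w x)))
    (ricci_identity_kahlerForm h)

theorem mdifferentiableAt_normSq (h : ∀ x, S.HasTorsion x (w x) (ξ x) (η x)) (x : M) :
    MDifferentiableAt (𝓡 6) 𝓘(ℝ, ℝ) (fun y ↦ Complex.normSq (w y)) x := by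
  simp only [Complex.normSq_apply]
  have hre := (contMDiff_re_w h x).mdifferentiableAt (n := ∞) (by simp)
  have him := (contMDiff_im_w h x).mdifferentiableAt (n := ∞) (by simp)
  exact (hre.mul hre).add (him.mul him)

theorem mvfderiv_normSq_eq_zero (h : ∀ x, S.HasTorsion x (w x) (ξ x) (η x)) (x : M) :
    mvfderiv (𝓡 6) (fun y ↦ Complex.normSq (w y)) x = 0 := by
  have hre := (contMDiff_re_w h x).mdifferentiableAt (n := ∞) (by simp)
  have him := (contMDiff_im_w h x).mdifferentiableAt (n := ∞) (by simp)
  ext u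
  have h0 := DFunLike.congr_fun (volReDeriv_eq_zero h x) u
  have h0re : mvfderiv (𝓡 6) (fun y ↦ (w y).re) x u + 3 * η x u * (w x).im = 0 :=
    congrArg Complex.re h0
  have h0im : -mvfderiv (𝓡 6) (fun y ↦ (w y).im) x u + 3 * η x u * (w x).re = 0 :=
    congrArg Complex.im h0
  have hmul : mvfderiv (𝓡 6) (fun y ↦ Complex.normSq (w y)) x u =
      2 * (w x).re * mvfderiv (𝓡 6) (fun y ↦ (w y).re) x u
      + 2 * (w x).im * mvfderiv (𝓡 6) (fun y ↦ (w y).im) x u := by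
    simp only [Complex.normSq_apply]
    refine (DFunLike.congr_fun (mvfderiv_fun_add (hre.mul hre) (him.mul him)) u).trans ?_
    rw [add_apply, mvfderiv_mul hre hre, mvfderiv_mul him him]
    simp only [add_apply, smul_apply, smul_eq_mul]
    ring
  rw [hmul, zero_apply]
  linear_combination 2 * (w x).re * h0re - 2 * (w x).im * h0im

theorem exists_forall_normSq_eq [ConnectedSpace M]
    (h : ∀ x, S.HasTorsion x (w x) (ξ x) (η x)) : ∃ α, ∀ x, Complex.normSq (w x) = α :=
  (isLocallyConstant_of_mvfderiv_eq_zero (mdifferentiableAt_normSq h)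
    (mvfderiv_normSq_eq_zero h)).exists_eq_const.imp fun _ ↦ congrFun

theorem mdifferentiableAt_inner_mul_kahlerForm {A B C D : Π y : M, TangentSpace (𝓡 6) y}
    (hA : ContMDiffAt (𝓡 6) (𝓡 6).tangent ∞ (T% A) x)
    (hB : ContMDiffAt (𝓡 6) (𝓡 6).tangent ∞ (T% B) x)
    (hC : ContMDiffAt (𝓡 6) (𝓡 6).tangent ∞ (T% C) x)
    (hD : ContMDiffAt (𝓡 6) (𝓡 6).tangent ∞ (T% D) x) :
    MDifferentiableAt (𝓡 6) 𝓘(ℝ, ℝ) (fun y ↦ ⟪A y, B y⟫ * ⟪C y, S.J y (D y)⟫) x :=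
  ((contMDiffAt_inner hA hB).mul (contMDiffAt_inner hC (S.contMDiffAt_J hD))).mdifferentiableAt
    (by simp)

theorem mvfderiv_inner_mul_kahlerForm (h : ∀ x, S.HasTorsion x (w x) (ξ x) (η x))
    {A B C D : Π y : M, TangentSpace (𝓡 6) y}
    (hA : ContMDiffAt (𝓡 6) (𝓡 6).tangent ∞ (T% A) x)
    (hB : ContMDiffAt (𝓡 6) (𝓡 6).tangent ∞ (T% B) x)
    (hC : ContMDiffAt (𝓡 6) (𝓡 6).tangent ∞ (T% C) x)
    (hD : ContMDiffAt (𝓡 6) (𝓡 6).tangent ∞ (T% D) x) (u : TangentSpace (𝓡 6) x) :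
    mvfderiv (𝓡 6) (fun y ↦ ⟪A y, B y⟫ * ⟪C y, S.J y (D y)⟫) x u =
      ⟪leviCivita (𝓡 6) M A x u, B x⟫ * ⟪C x, S.J x (D x)⟫
      + ⟪A x, leviCivita (𝓡 6) M B x u⟫ * ⟪C x, S.J x (D x)⟫
      + ⟪A x, B x⟫ * ⟪leviCivita (𝓡 6) M C x u, S.J x (D x)⟫
      + ⟪A x, B x⟫ * ⟪C x, S.J x (leviCivita (𝓡 6) M D x u)⟫
      + ⟪A x, B x⟫ * S.volRe w x ![u, C x, D x] := by
  have hkahler : mvfderiv (𝓡 6) (fun y ↦ ⟪C y, S.J y (D y)⟫) x u =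
      ⟪leviCivita (𝓡 6) M C x u, S.J x (D x)⟫ + ⟪C x, S.J x (leviCivita (𝓡 6) M D x u)⟫
      + S.volRe w x ![u, C x, D x] := by
    have hcov := (hasCovDeriv_kahlerForm h).mvfderiv_eq x ![C, D]
      (by intro i; fin_cases i; exacts [hC, hD]) u
    rw [Fin.sum_univ_two] at hcov
    refine hcov.trans ?_
    congr 2
    ext i
    fin_cases i <;> rfl
  have hAB := (contMDiffAt_inner hA hB).mdifferentiableAt (by simp)
  have hCD := (contMDiffAt_inner hC (S.contMDiffAt_J hD)).mdifferentiableAt (by simp)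
  have hd {X : Π y : M, TangentSpace (𝓡 6) y}
      (hX : ContMDiffAt (𝓡 6) (𝓡 6).tangent ∞ (T% X) x) := hX.mdifferentiableAt (by simp)
  refine (DFunLike.congr_fun (mvfderiv_fun_mul hAB hCD) u).trans ?_
  rw [add_apply, smul_apply, smul_apply, hkahler, mvfderiv_inner (hd hA) (hd hB), smul_eq_mul,
    smul_eq_mul]
  ring

theorem hasCovDeriv_wedgeKahler (h : ∀ x, S.HasTorsion x (w x) (ξ x) (η x)) :
    HasCovDeriv S.wedgeKahler fun y v ↦ ∑ k : Fin 3, ⟪v 1, v k.succ.succ⟫ *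
      S.volRe w y (Function.update (Matrix.vecTail (Matrix.vecTail v)) k (v 0)) := by
  have hd {y : M} {V : Fin 4 → Π z : M, TangentSpace (𝓡 6) z}
      (hV : ∀ i, ContMDiffAt (𝓡 6) (𝓡 6).tangent ∞ (T% (V i)) y) (i j k l) :=
    mdifferentiableAt_inner_mul_kahlerForm (S := S) (hV i) (hV j) (hV k) (hV l)
  refine ⟨fun y V hV ↦ ((hd hV 0 1 2 3).sub (hd hV 0 2 1 3)).add (hd hV 0 3 1 2),
    fun y V hV u ↦ ?_⟩
  have hderiv (i j k l) := mvfderiv_inner_mul_kahlerForm h (hV i) (hV j) (hV k) (hV l) u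
  simp only [wedgeKahler]
  refine (DFunLike.congr_fun
    (mvfderiv_fun_add ((hd hV 0 1 2 3).sub (hd hV 0 2 1 3)) (hd hV 0 3 1 2)) u).trans ?_
  rw [add_apply, mvfderiv_sub (hd hV 0 1 2 3) (hd hV 0 2 1 3), sub_apply, hderiv, hderiv, hderiv,
    sum_mul_volRe_update, Fin.sum_univ_four]
  simp [Matrix.vecTail]
  ring

theorem hasCovDeriv_volRe_of_normSq_eq (h : ∀ x, S.HasTorsion x (w x) (ξ x) (η x)) {α : ℝ}
    (hα : ∀ x, Complex.normSq (w x) = α) :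
    HasCovDeriv (fun y ↦ S.volRe w y) fun y v ↦ -α * S.wedgeKahler y v :=
  (hasCovDeriv_volRe h).congr fun y v ↦ by
    rw [volReDeriv_eq_zero h, hα, LinearMap.zero_apply, zero_mul, Complex.zero_re, add_zero,
      neg_mul]

theorem sum_volRe_update_curvatureSubSphere (h : ∀ x, S.HasTorsion x (w x) (ξ x) (η x)) {α : ℝ}
    (hα : ∀ x, Complex.normSq (w x) = α) (u v : TangentSpace (𝓡 6) x)
    (a : Fin 3 → TangentSpace (𝓡 6) x) :
    ∑ k, S.volRe w x (Function.update a k (curvatureSubSphere α u v (a k))) = 0 := by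
  have hricci := (hasCovDeriv_volRe_of_normSq_eq h hα).ricci_identity (isSmoothForm_volRe h)
    ((hasCovDeriv_wedgeKahler h).fun_mul (f := fun _ ↦ -α) fun _ ↦ mdifferentiableAt_const) u v a
  simp only [mvfderiv_const, zero_apply, mul_zero, add_zero, Matrix.cons_val_one,
    Matrix.cons_val_zero, Matrix.cons_val_succ, Matrix.tail_cons] at hricci
  simp only [curvatureSubSphere_apply, MultilinearMap.map_update_sub, MultilinearMap.map_update_add,
    MultilinearMap.map_update_smul, Finset.sum_add_distrib, Finset.sum_sub_distrib, hricci,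
    smul_eq_mul, mul_assoc, ← Finset.mul_sum]
  ring

theorem ricci_eq (h : ∀ x, S.HasTorsion x (w x) (ξ x) (η x)) {α : ℝ} (hα0 : α ≠ 0)
    (hα : ∀ x, Complex.normSq (w x) = α) (u v : TangentSpace (𝓡 6) x) :
    ricci (𝓡 6) M x u v = 5 * α * ⟪u, v⟫ ∧ ricciStar M S.J x u v = α * ⟪u, v⟫ := by
  obtain ⟨c, hc⟩ := S.exists_isSpecialUnitaryCoord x
  have hJ := S.isOrthogonalComplexStructure x
  have hK : IsAlgebraicCurvature (riemann (𝓡 6) M x) := isAlgebraicCurvature_riemann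
  have hKJ (u v y z : TangentSpace (𝓡 6) x) : riemann (𝓡 6) M x u v y (S.Jlin x z)
      - α * sphereCurvature u v y (S.Jlin x z)
      + (riemann (𝓡 6) M x u v (S.Jlin x y) z - α * sphereCurvature u v (S.Jlin x y) z) = 0 := by
    have := ricci_identity_kahlerForm h u v y z
    rwa [volReDeriv_eq_zero h, hα, LinearMap.zero_apply, LinearMap.zero_apply, zero_mul, zero_mul,
      sub_zero, Complex.zero_re] at this
  have hw : conj (w x) ≠ 0 := by
    rwa [map_ne_zero, ← map_ne_zero Complex.normSq, hα]
  let b := stdOrthonormalBasis ℝ (TangentSpace (𝓡 6) x)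
  have htr (u v : TangentSpace (𝓡 6) x) : ∑ i, (riemann (𝓡 6) M x u v (b i) (S.Jlin x (b i))
      - α * sphereCurvature u v (b i) (S.Jlin x (b i))) = 0 := by
    simp only [← inner_curvatureSubSphere]
    refine hc.sum_inner_J_eq_zero hJ hw (fun y z ↦ ?_) (fun y ↦ ?_) (fun a ↦ ?_) b
    · rw [inner_curvatureSubSphere, inner_curvatureSubSphere, (hK.sub_sphereCurvature α).swap₃₄]
    · refine ext_inner_right ℝ fun z ↦ ?_
      rw [hJ.inner_J_left, inner_curvatureSubSphere, inner_curvatureSubSphere]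
      linarith [hKJ u v y z]
    · rw [Finset.mul_sum, Complex.re_sum]
      simpa only [volRe_eq_re] using sum_volRe_update_curvatureSubSphere h hα u v a
  obtain ⟨hric, hricStar⟩ := hK.ricci_eq_of_sub_sphereCurvature hJ hKJ b htr u v
  refine ⟨hric.trans ?_, hricStar⟩
  have hdim : Module.finrank ℝ (TangentSpace (𝓡 6) x) = 6 :=
    (finrank_euclideanSpace_fin : Module.finrank ℝ E6 = 6)
  rw [Fintype.card_fin, hdim]
  push_cast
  ring

end SU3Structure

end NearlyKahlerCurvature

theorem theorem3p5 {M : Type*} [TopologicalSpace M] [T2Space M] [SecondCountableTopology M]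
    [ConnectedSpace M] [ChartedSpace (EuclideanSpace ℝ (Fin 6)) M] [IsManifold (𝓡 6) ∞ M]
    [RiemannianBundle (fun x : M ↦ TangentSpace (𝓡 6) x)]
    [IsContMDiffRiemannianBundle (𝓡 6) ∞ (EuclideanSpace ℝ (Fin 6))
      (fun x : M ↦ TangentSpace (𝓡 6) x)]
    (S : SU3Structure M) (htype : S.IsOfType S.W1pW1mW5) (hnot : ¬ S.IsOfType S.W5) :
    ∃ w₁p w₁m : M → ℝ,
      ContMDiff (𝓡 6) 𝓘(ℝ, ℝ) ∞ w₁p ∧ ContMDiff (𝓡 6) 𝓘(ℝ, ℝ) ∞ w₁m ∧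
      (∀ (x : M) (u v w : TangentSpace (𝓡 6) x),
        S.nablaKahler x u v w = w₁p x * S.ψp x ![u, v, w] + w₁m x * S.ψm x ![u, v, w]) ∧
      ∃ α : ℝ, 0 < α ∧ (∀ x : M, α = w₁p x ^ 2 + w₁m x ^ 2) ∧
        ∀ (x : M) (u v : TangentSpace (𝓡 6) x),
          ricci (𝓡 6) M x u v = 5 * ricciStar M S.J x u v ∧
          ricci (𝓡 6) M x u v = 5 * α * inner ℝ u v := by
  choose T hT hmem using htype
  choose w ξ η h using fun x ↦ S.exists_hasTorsion (hT x) (hmem x)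
  obtain ⟨α, hα⟩ := SU3Structure.exists_forall_normSq_eq h
  have hα0 : α ≠ 0 := by
    rintro rfl
    exact hnot fun x ↦ (h x).exists_mem_W5 (Complex.normSq_eq_zero.1 (hα x))
  obtain ⟨x₀⟩ : Nonempty M := inferInstance
  have hαpos : 0 < α := (hα x₀ ▸ Complex.normSq_nonneg (w x₀)).lt_of_ne' hα0
  refine ⟨fun x ↦ (w x).re, fun x ↦ (w x).im, SU3Structure.contMDiff_re_w h,
    SU3Structure.contMDiff_im_w h, fun x u v y ↦ ?_, α, hαpos, fun x ↦ ?_, fun x u v ↦ ?_⟩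
  · rw [← S.volRe_eq, S.volRe_eq_re]
    exact (h x).covDerivForm_kahlerForm u v y
  · rw [← hα x, Complex.normSq_apply]
    ring
  · obtain ⟨hric, hricStar⟩ := SU3Structure.ricci_eq h hα0 hα u v
    exact ⟨by rw [hric, hricStar, mul_assoc], hric⟩
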